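/- Let $K$ be a field of characteristic $0$ and let $q\in K^\times$ not be a root of unity (for instance $K=k(q)$, the field of rational functions in an indeterminate $q$ over a field $k$ of characteristic $0$). Let $A=C_q(B_+)$ be the Hopf algebra over $K$ generated by $X,g,g^{-1}$ with relations $gg^{-1}=g^{-1}g=1$, $Xg=q\,gX$, and $$\Delta X=X\otimes 1+g\otimes X,\quad \Delta g=g\otimes g,\quad \epsilon(X)=0,\quad \epsilon(g)=1,\quad SX=-g^{-1}X,\quad Sg=g^{-1}.$$ A differential calculus on $A$ means a bicovariant first order differential calculus: an $A$-bimodule $\Gamma$ with a $K$-linear map $\mathrm d:A\to\Gamma$ such that $\mathrm d(ab)=a\,\mathrm db+(\mathrm da)\,b$, $\Gamma$ is spanned by the elements $a\,\mathrm db$, and there are linear maps $\Delta_L:\Gamma\to A\otimes\Gamma$ and $\Delta_R:\Gamma\to\Gamma\otimes A$ with $\Delta_L(a\,\mathrm db)=\Delta(a)(\mathrm{id}\otimes\mathrm d)\Delta(b)$ and $\Delta_R(a\,\mathrm db)=\Delta(a)(\mathrm d\otimes\mathrm{id})\Delta(b)$. Its dimension is the dimension over $K$ of the space of right invariant one-forms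 $\{\omega\in\Gamma:\Delta_R\,\omega=\omega\otimes 1\}$. Isomorphisms of calculi are bimodule isomorphisms intertwining the differentials. A calculus is coirreducible if it is nonzero and its only quotient calculi are, up to isomorphism, $0$ and itself. Then, up to isomorphism, there is exactly one differential calculus $\Gamma$ of dimension $2$ on $A$. It is coirreducible and, with $[a,\omega]_p:=a\omega-p\,\omega a$ and $[a,\omega]:=[a,\omega]_1$, it obeys the relations $$[g,\mathrm dX]=0,\qquad [g,\mathrm dg]_q=0,\qquad [X,\mathrm dX]_q=0,\qquad [X,\mathrm dg]_q=(q-1)(\mathrm dX)\,g .$$ Moreover, for every $f$ in the commutative algebra $K[X,g,g^{-1}]$, $$\mathrm d{:}f{:}=(\mathrm dg)\,{:}\partial_{q,g}f{:}+(\mathrm dX)\,{:}\partial_{q,X}f{:},$$ where the normal ordering ${:}\cdot{:}:K[X,g,g^{-1}]\to A$ is the linear map $g^nX^m\mapsto g^nX^m$ ($n\in\mathbb Z$, $m\ge 0$) and $(\partial_{q,x}f)(x)=\dfrac{f(x)-f(qx)}{x(1-q)}$ for $x=g$ and $x=X$. -/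

import Mathlib

open scoped TensorProduct

universe u v w w'

/-! ### Bicovariant first order differential calculi over a bialgebra -/

/-- A first order differential calculus over the `K`-algebra `A`: an `A`-bimodule `Γ` (on which the
two actions of the scalars `K` agree) with a `K`-linear map `d : A → Γ` that satisfies the Leibniz
rule and such that `Γ` is spanned by the elements `a • d b`. The right action of `A` is the action
of `Aᵐᵒᵖ`. -/
structure FirstOrderCalculus (K : Type u) (A : Type v) [Field K] [Ring A] [Algebra K A] where
  carrier : Type w
  [instAddCommGroup : AddCommGroup carrier]
  [instModule : Module K carrier]
  [instModuleLeft : Module A carrier]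
  [instModuleRight : Module Aᵐᵒᵖ carrier]
  [instTowerLeft : IsScalarTower K A carrier]
  [instTowerRight : IsScalarTower K Aᵐᵒᵖ carrier]
  [instBimodule : SMulCommClass A Aᵐᵒᵖ carrier]
  d : A →ₗ[K] carrier
  leibniz : ∀ a b : A, d (a * b) = a • d b + MulOpposite.op b • d a
  span_d : Submodule.span A (Set.range d) = ⊤

attribute [instance] FirstOrderCalculus.instAddCommGroup FirstOrderCalculus.instModule
  FirstOrderCalculus.instModuleLeft FirstOrderCalculus.instModuleRight
  FirstOrderCalculus.instTowerLeft FirstOrderCalculus.instTowerRight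
  FirstOrderCalculus.instBimodule

namespace FirstOrderCalculus

variable {K : Type u} {A : Type v} [Field K] [Ring A] [Algebra K A]

/-- A morphism of calculi: a bimodule map that intertwines the differentials. -/
structure Hom (Γ : FirstOrderCalculus.{u, v, w} K A) (Γ' : FirstOrderCalculus.{u, v, w'} K A) where
  toLinearMap : Γ.carrier →ₗ[A] Γ'.carrier
  map_op_smul : ∀ (a : A) (ω : Γ.carrier),
    toLinearMap (MulOpposite.op a • ω) = MulOpposite.op a • toLinearMap ω
  map_d : ∀ a : A, toLinearMap (Γ.d a) = Γ'.d a

/-- Two calculi are isomorphic if there is a bijective morphism between them. -/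
def IsIsomorphic (Γ : FirstOrderCalculus.{u, v, w} K A) (Γ' : FirstOrderCalculus.{u, v, w'} K A) :
    Prop :=
  ∃ φ : Hom Γ Γ', Function.Bijective φ.toLinearMap

/-- The left action of `A ⊗ A` on `A ⊗ Γ`: `(a ⊗ b) • (c ⊗ ω) = a c ⊗ b ω`. -/
noncomputable def smulLeft (Γ : FirstOrderCalculus.{u, v, w} K A) :
    A ⊗[K] A →ₗ[K] A ⊗[K] Γ.carrier →ₗ[K] A ⊗[K] Γ.carrier :=
  TensorProduct.map₂ (LinearMap.mul K A) (Algebra.lsmul K K Γ.carrier).toLinearMap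

/-- The left action of `A ⊗ A` on `Γ ⊗ A`: `(a ⊗ b) • (ω ⊗ c) = a ω ⊗ b c`. -/
noncomputable def smulRight (Γ : FirstOrderCalculus.{u, v, w} K A) :
    A ⊗[K] A →ₗ[K] Γ.carrier ⊗[K] A →ₗ[K] Γ.carrier ⊗[K] A :=
  TensorProduct.map₂ (Algebra.lsmul K K Γ.carrier).toLinearMap (LinearMap.mul K A)

/-- The `p`-commutator `[a, ω]_p = a ω - p ω a` of an algebra element and a one-form. -/
def qComm (Γ : FirstOrderCalculus.{u, v, w} K A) (p : K) (a : A) (ω : Γ.carrier) : Γ.carrier :=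
  a • ω - p • (MulOpposite.op a • ω)

end FirstOrderCalculus

/-- A bicovariant first order differential calculus (Woronowicz): there are linear maps
`Δ_L : Γ → A ⊗ Γ` and `Δ_R : Γ → Γ ⊗ A` with `Δ_L (a db) = Δ(a) (id ⊗ d)Δ(b)` and
`Δ_R (a db) = Δ(a) (d ⊗ id)Δ(b)`. As the elements `a db` span `Γ`, these maps are determined by
`(Γ, d)`, and they are automatically coactions that make `Γ` a bicovariant bimodule. -/
structure BicovariantCalculus (K : Type u) (A : Type v) [Field K] [Ring A] [Bialgebra K A]
    extends FirstOrderCalculus.{u, v, w} K A where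
  coactL : carrier →ₗ[K] A ⊗[K] carrier
  coactR : carrier →ₗ[K] carrier ⊗[K] A
  coactL_smul_d : ∀ a b : A, coactL (a • d b) =
    toFirstOrderCalculus.smulLeft (Coalgebra.comul (R := K) a)
      (d.lTensor A (Coalgebra.comul (R := K) b))
  coactR_smul_d : ∀ a b : A, coactR (a • d b) =
    toFirstOrderCalculus.smulRight (Coalgebra.comul (R := K) a)
      (d.rTensor A (Coalgebra.comul (R := K) b))

namespace BicovariantCalculus

variable {K : Type u} {A : Type v} [Field K] [Ring A] [Bialgebra K A]

/-- The right invariant one-forms, `Δ_R ω = ω ⊗ 1`. -/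
def rightInvariants (Γ : BicovariantCalculus.{u, v, w} K A) : Submodule K Γ.carrier :=
  LinearMap.ker (Γ.coactR - (TensorProduct.mk K Γ.carrier A).flip 1)

/-- The dimension of a bicovariant calculus: the number of elements of a basis of the space of
right invariant one-forms. -/
noncomputable def dim (Γ : BicovariantCalculus.{u, v, w} K A) : Cardinal :=
  Module.rank K Γ.rightInvariants

/-- A calculus is coirreducible if it is not zero and admits no proper quotient calculus: each
morphism to a nonzero bicovariant calculus (it is automatically surjective, since it intertwines
the differentials) is bijective. -/
def IsCoirreducible (Γ : BicovariantCalculus.{u, v, w} K A) : Prop :=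
  Nontrivial Γ.carrier ∧
    ∀ (Γ' : BicovariantCalculus.{u, v, w} K A)
      (φ : FirstOrderCalculus.Hom Γ.toFirstOrderCalculus Γ'.toFirstOrderCalculus),
      Nontrivial Γ'.carrier → Function.Bijective φ.toLinearMap

end BicovariantCalculus

/-! ### The quantum group `C_q(B_+)` -/

/-- The names of the generators `X`, `g`, `g⁻¹`. -/
inductive CqBGen : Type
  | X
  | g
  | gInv

/-- The defining relations `g g⁻¹ = 1`, `g⁻¹ g = 1`, `X g = q g X`. -/
inductive CqBRel {K : Type u} [Field K] (q : K) :
    FreeAlgebra K CqBGen → FreeAlgebra K CqBGen → Prop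
  | mul_inv : CqBRel q (FreeAlgebra.ι K CqBGen.g * FreeAlgebra.ι K CqBGen.gInv) 1
  | inv_mul : CqBRel q (FreeAlgebra.ι K CqBGen.gInv * FreeAlgebra.ι K CqBGen.g) 1
  | comm : CqBRel q (FreeAlgebra.ι K CqBGen.X * FreeAlgebra.ι K CqBGen.g)
      (q • (FreeAlgebra.ι K CqBGen.g * FreeAlgebra.ι K CqBGen.X))

/-- The algebra `C_q(B_+)` (as an algebra, `U_q(b_+)`) with generators `X`, `g`, `g⁻¹` and relations
`g g⁻¹ = g⁻¹ g = 1`, `X g = q g X`. -/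
def CqB {K : Type u} [Field K] (q : K) : Type u := RingQuot (CqBRel q)

namespace CqB

variable {K : Type u} [Field K] (q : K)

noncomputable instance : Ring (CqB q) := inferInstanceAs (Ring (RingQuot (CqBRel q)))

noncomputable instance : Algebra K (CqB q) := inferInstanceAs (Algebra K (RingQuot (CqBRel q)))

/-- The quotient map from the free algebra. -/
noncomputable def mk : FreeAlgebra K CqBGen →ₐ[K] CqB q := RingQuot.mkAlgHom K (CqBRel q)

/-- The generator `X`. -/
noncomputable def X : CqB q := mk q (FreeAlgebra.ι K CqBGen.X)

/-- The invertible generator `g`, as a unit with inverse `g⁻¹`. -/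
noncomputable def gUnit : (CqB q)ˣ where
  val := mk q (FreeAlgebra.ι K CqBGen.g)
  inv := mk q (FreeAlgebra.ι K CqBGen.gInv)
  val_inv := by
    rw [← map_mul, ← map_one (mk q)]; exact RingQuot.mkAlgHom_rel K CqBRel.mul_inv
  inv_val := by
    rw [← map_mul, ← map_one (mk q)]; exact RingQuot.mkAlgHom_rel K CqBRel.inv_mul

/-- The generator `g`. -/
noncomputable def g : CqB q := (gUnit q : CqB q)

/-- The generator `g⁻¹`. -/
noncomputable def gInv : CqB q := ((gUnit q)⁻¹ : (CqB q)ˣ)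

theorem g_mul_gInv : g q * gInv q = 1 := (gUnit q).mul_inv

theorem gInv_mul_g : gInv q * g q = 1 := (gUnit q).inv_mul

theorem X_mul_g : X q * g q = q • (g q * X q) := by
  change mk q _ * mk q _ = q • (mk q _ * mk q _)
  rw [← map_mul, ← map_mul, ← map_smul]
  exact RingQuot.mkAlgHom_rel K CqBRel.comm

theorem gInv_mul_X : gInv q * X q = q • (X q * gInv q) := by
  calc gInv q * X q = gInv q * (X q * g q) * gInv q := by
        rw [mul_assoc, mul_assoc, g_mul_gInv, mul_one]
    _ = q • (X q * gInv q) := by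
        rw [X_mul_g, mul_smul_comm, smul_mul_assoc, ← mul_assoc, gInv_mul_g, one_mul]

section lift

variable {q} {B : Type*} [Ring B] [Algebra K B]

/-- The universal property of `C_q(B_+)`. -/
noncomputable def lift (x y z : B) (hyz : y * z = 1) (hzy : z * y = 1)
    (hxy : x * y = q • (y * x)) : CqB q →ₐ[K] B :=
  RingQuot.liftAlgHom K ⟨FreeAlgebra.lift K fun i => match i with
    | CqBGen.X => x
    | CqBGen.g => y
    | CqBGen.gInv => z, by
      rintro _ _ (_ | _ | _) <;> simp [hyz, hzy, hxy]⟩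

variable (x y z : B) (hyz : y * z = 1) (hzy : z * y = 1) (hxy : x * y = q • (y * x))

@[simp] theorem lift_X : lift x y z hyz hzy hxy (X q) = x := by
  refine (RingQuot.liftAlgHom_mkAlgHom_apply K _ _ _).trans ?_
  simp

@[simp] theorem lift_g : lift x y z hyz hzy hxy (g q) = y := by
  refine (RingQuot.liftAlgHom_mkAlgHom_apply K _ _ _).trans ?_
  simp

@[simp] theorem lift_gInv : lift x y z hyz hzy hxy (gInv q) = z := by
  refine (RingQuot.liftAlgHom_mkAlgHom_apply K _ _ _).trans ?_
  simp

theorem hom_ext {φ ψ : CqB q →ₐ[K] B} (hX : φ (X q) = ψ (X q)) (hg : φ (g q) = ψ (g q))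
    (hi : φ (gInv q) = ψ (gInv q)) : φ = ψ := by
  refine RingQuot.ringQuot_ext' K φ ψ (FreeAlgebra.hom_ext ?_)
  funext i
  cases i
  · exact hX
  · exact hg
  · exact hi

end lift

variable {q} in
theorem induction {P : CqB q → Prop} (hs : ∀ c : K, P (algebraMap K _ c)) (hX : P (X q))
    (hg : P (g q)) (hi : P (gInv q)) (hm : ∀ a b, P a → P b → P (a * b))
    (ha : ∀ a b, P a → P b → P (a + b)) (a : CqB q) : P a := by
  obtain ⟨a, rfl⟩ := RingQuot.mkAlgHom_surjective K (CqBRel q) a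
  change P (mk q a)
  induction a using FreeAlgebra.induction with
  | grade0 c => rw [AlgHom.commutes]; exact hs c
  | grade1 i => cases i <;> assumption
  | mul a b h1 h2 => rw [map_mul]; exact hm _ _ h1 h2
  | add a b h1 h2 => rw [map_add]; exact ha _ _ h1 h2

/-- The coproduct: `Δ X = X ⊗ 1 + g ⊗ X`, `Δ g = g ⊗ g`. -/
noncomputable def comulHom : CqB q →ₐ[K] CqB q ⊗[K] CqB q :=
  lift (X q ⊗ₜ 1 + g q ⊗ₜ X q) (g q ⊗ₜ g q) (gInv q ⊗ₜ gInv q)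
    (by simp [g_mul_gInv, Algebra.TensorProduct.one_def])
    (by simp [gInv_mul_g, Algebra.TensorProduct.one_def])
    (by simp [add_mul, mul_add, X_mul_g, TensorProduct.smul_tmul'])

/-- The counit: `ε(X) = 0`, `ε(g) = 1`. -/
noncomputable def counitHom : CqB q →ₐ[K] K :=
  lift 0 1 1 (by simp) (by simp) (by simp)

/-- The antipode, as a homomorphism to the opposite algebra: `S X = -g⁻¹ X`, `S g = g⁻¹`. -/
noncomputable def antipodeHom : CqB q →ₐ[K] (CqB q)ᵐᵒᵖ :=
  lift (MulOpposite.op (-(gInv q * X q))) (MulOpposite.op (gInv q)) (MulOpposite.op (g q))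
    (by rw [← MulOpposite.op_mul, g_mul_gInv, MulOpposite.op_one])
    (by rw [← MulOpposite.op_mul, gInv_mul_g, MulOpposite.op_one])
    (by
      rw [← MulOpposite.op_mul, ← MulOpposite.op_mul, ← MulOpposite.op_smul]
      congr 1
      rw [neg_mul, mul_neg, smul_neg, mul_assoc (gInv q) (X q), ← mul_smul_comm, ← gInv_mul_X])

noncomputable instance : Bialgebra K (CqB q) :=
  Bialgebra.ofAlgHom (comulHom q) (counitHom q)
    (by
      apply hom_ext <;>
        simp [comulHom, TensorProduct.add_tmul, TensorProduct.tmul_add,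
          Algebra.TensorProduct.one_def, add_assoc])
    (by apply hom_ext <;> simp [comulHom, counitHom])
    (by apply hom_ext <;> simp [comulHom, counitHom])

theorem comul_X : Coalgebra.comul (R := K) (X q) = X q ⊗ₜ 1 + g q ⊗ₜ X q :=
  lift_X _ _ _ _ _ _

theorem comul_g : Coalgebra.comul (R := K) (g q) = g q ⊗ₜ g q := lift_g _ _ _ _ _ _

theorem comul_gInv : Coalgebra.comul (R := K) (gInv q) = gInv q ⊗ₜ gInv q :=
  lift_gInv _ _ _ _ _ _

theorem counit_X : Coalgebra.counit (R := K) (X q) = 0 := lift_X _ _ _ _ _ _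

theorem counit_g : Coalgebra.counit (R := K) (g q) = 1 := lift_g _ _ _ _ _ _

theorem counit_gInv : Coalgebra.counit (R := K) (gInv q) = 1 := lift_gInv _ _ _ _ _ _

noncomputable instance : HopfAlgebraStruct K (CqB q) where
  antipode := (MulOpposite.opLinearEquiv K).symm.toLinearMap ∘ₗ (antipodeHom q).toLinearMap

theorem antipode_apply (a : CqB q) :
    HopfAlgebraStruct.antipode K a = (antipodeHom q a).unop := rfl

theorem antipode_X : HopfAlgebraStruct.antipode K (X q) = -(gInv q * X q) := by
  simp [antipode_apply, antipodeHom]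

theorem antipode_g : HopfAlgebraStruct.antipode K (g q) = gInv q := by
  simp [antipode_apply, antipodeHom]

theorem antipode_gInv : HopfAlgebraStruct.antipode K (gInv q) = g q := by
  simp [antipode_apply, antipodeHom]

theorem antipode_mul (a b : CqB q) : HopfAlgebraStruct.antipode K (a * b) =
    HopfAlgebraStruct.antipode K b * HopfAlgebraStruct.antipode K a := by
  simp [antipode_apply]

theorem antipode_algebraMap (c : K) :
    HopfAlgebraStruct.antipode K (algebraMap K (CqB q) c) = algebraMap K (CqB q) c := by
  rw [antipode_apply, AlgHom.commutes]; rfl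

theorem mul_antipode_aux (s : CqB q ⊗[K] CqB q) (c : K)
    (h : LinearMap.mul' K _ ((HopfAlgebraStruct.antipode K).rTensor _ s) = algebraMap K _ c)
    (t : CqB q ⊗[K] CqB q) :
    LinearMap.mul' K _ ((HopfAlgebraStruct.antipode K).rTensor _ (s * t)) =
      c • LinearMap.mul' K _ ((HopfAlgebraStruct.antipode K).rTensor _ t) := by
  induction t with
  | zero => simp
  | add x y hx hy => rw [mul_add]; simp only [map_add, hx, hy, smul_add]
  | tmul x y =>
    have key : ∀ s : CqB q ⊗[K] CqB q,
        LinearMap.mul' K _ ((HopfAlgebraStruct.antipode K).rTensor _ (s * x ⊗ₜ y)) =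
          HopfAlgebraStruct.antipode K x *
            LinearMap.mul' K _ ((HopfAlgebraStruct.antipode K).rTensor _ s) * y := by
      intro s
      induction s with
      | zero => simp
      | add s t hs ht => rw [add_mul]; simp only [map_add, hs, ht, mul_add, add_mul]
      | tmul s t => simp [antipode_mul, mul_assoc]
    rw [key, h, ← Algebra.commutes, mul_assoc, ← Algebra.smul_def]
    simp

theorem mul_antipode_aux' (t : CqB q ⊗[K] CqB q) (c : K)
    (h : LinearMap.mul' K _ ((HopfAlgebraStruct.antipode K).lTensor _ t) = algebraMap K _ c)
    (s : CqB q ⊗[K] CqB q) :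
    LinearMap.mul' K _ ((HopfAlgebraStruct.antipode K).lTensor _ (s * t)) =
      c • LinearMap.mul' K _ ((HopfAlgebraStruct.antipode K).lTensor _ s) := by
  induction s with
  | zero => simp
  | add x y hx hy => rw [add_mul]; simp only [map_add, hx, hy, smul_add]
  | tmul x y =>
    have key : ∀ t : CqB q ⊗[K] CqB q,
        LinearMap.mul' K _ ((HopfAlgebraStruct.antipode K).lTensor _ (x ⊗ₜ y * t)) =
          x * LinearMap.mul' K _ ((HopfAlgebraStruct.antipode K).lTensor _ t) *
            HopfAlgebraStruct.antipode K y := by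
      intro s
      induction s with
      | zero => simp
      | add s t hs ht => rw [mul_add]; simp only [map_add, hs, ht, mul_add, add_mul]
      | tmul s t => simp [antipode_mul, mul_assoc]
    rw [key, h, ← Algebra.commutes, mul_assoc, ← Algebra.smul_def]
    simp

noncomputable instance : HopfAlgebra K (CqB q) where
  mul_antipode_rTensor_comul := by
    ext a
    induction a using induction with
    | hs c =>
      simp [Bialgebra.comul_algebraMap, Algebra.TensorProduct.algebraMap_apply,
        antipode_algebraMap]
    | hX => simp [comul_X, counit_X, antipode_X, antipode_g]
    | hg => simp [comul_g, counit_g, antipode_g, gInv_mul_g]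
    | hi => simp [comul_gInv, counit_gInv, antipode_gInv, g_mul_gInv]
    | ha a b h1 h2 => simpa using congrArg₂ (· + ·) h1 h2
    | hm a b h1 h2 =>
      simp only [LinearMap.comp_apply, Algebra.linearMap_apply] at h1 h2 ⊢
      rw [Bialgebra.comul_mul, mul_antipode_aux q _ _ h1, h2, Bialgebra.counit_mul, map_mul,
        Algebra.smul_def]
  mul_antipode_lTensor_comul := by
    ext a
    induction a using induction with
    | hs c =>
      have := antipode_algebraMap q 1
      simp only [map_one] at this
      simp [Bialgebra.comul_algebraMap, Algebra.TensorProduct.algebraMap_apply, this]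
    | hX =>
      have := antipode_algebraMap q 1
      simp only [map_one] at this
      simp [comul_X, counit_X, antipode_X, ← mul_assoc, g_mul_gInv, this]
    | hg => simp [comul_g, counit_g, antipode_g, g_mul_gInv]
    | hi => simp [comul_gInv, counit_gInv, antipode_gInv, gInv_mul_g]
    | ha a b h1 h2 => simpa using congrArg₂ (· + ·) h1 h2
    | hm a b h1 h2 =>
      simp only [LinearMap.comp_apply, Algebra.linearMap_apply] at h1 h2 ⊢
      rw [Bialgebra.comul_mul, mul_antipode_aux' q _ _ h2, h1, Bialgebra.counit_mul, mul_comm,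
        map_mul, Algebra.smul_def]

end CqB

/-! ### Commutative polynomials in `X, g, g⁻¹`, normal ordering and `q`-derivatives -/

/-- The commutative algebra `K[X, g, g⁻¹]`: the monomial `g ^ n * X ^ m` has exponent `(n, m)`. -/
abbrev PolyXg (K : Type u) [Field K] : Type u := AddMonoidAlgebra K (ℤ × ℕ)

namespace PolyXg

variable {K : Type u} [Field K] (q : K)

/-- The monomial `c * g ^ n * X ^ m`. -/
noncomputable def monomial (n : ℤ) (m : ℕ) (c : K) : PolyXg K := AddMonoidAlgebra.single (n, m) c

/-- The linear map on `K[X, g, g⁻¹]` with prescribed values at the monomials `g ^ n * X ^ m`. -/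
noncomputable def extend {V : Type*} [AddCommGroup V] [Module K V] (e : ℤ → ℕ → V) :
    PolyXg K →ₗ[K] V :=
  Finsupp.linearCombination K (fun p : ℤ × ℕ => e p.1 p.2) ∘ₗ
    (AddMonoidAlgebra.coeffLinearEquiv K).toLinearMap

@[simp] theorem extend_monomial {V : Type*} [AddCommGroup V] [Module K V] (e : ℤ → ℕ → V)
    (n : ℤ) (m : ℕ) (c : K) : extend e (monomial n m c) = c • e n m := by
  simp [extend, monomial]

/-- Normal ordering `K[X, g, g⁻¹] → C_q(B_+)`, `g ^ n * X ^ m ↦ g ^ n * X ^ m`. -/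
noncomputable def normalOrder : PolyXg K →ₗ[K] CqB q :=
  extend fun n m => ((CqB.gUnit q ^ n : (CqB q)ˣ) : CqB q) * CqB.X q ^ m

/-- The dilation `f(g, X) ↦ f(q g, X)`. -/
noncomputable def dilateG : PolyXg K →ₗ[K] PolyXg K := extend fun n m => monomial n m (q ^ n)

/-- The dilation `f(g, X) ↦ f(g, q X)`. -/
noncomputable def dilateX : PolyXg K →ₗ[K] PolyXg K := extend fun n m => monomial n m (q ^ m)

/-- The `q`-derivative `(f(g, X) - f(q g, X)) / (g (1 - q))` with respect to `g`. -/
noncomputable def qDerivG : PolyXg K →ₗ[K] PolyXg K :=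
  extend fun n m => monomial (n - 1) m ((1 - q ^ n) / (1 - q))

/-- The `q`-derivative `(f(g, X) - f(g, q X)) / (X (1 - q))` with respect to `X`
(for `m = 0` the coefficient `(1 - q ^ m) / (1 - q)` is zero). -/
noncomputable def qDerivX : PolyXg K →ₗ[K] PolyXg K :=
  extend fun n m => monomial n (m - 1) ((1 - q ^ m) / (1 - q))

theorem linearMap_ext {V : Type*} [AddCommGroup V] [Module K V] {φ ψ : PolyXg K →ₗ[K] V}
    (h : ∀ n m, φ (monomial n m 1) = ψ (monomial n m 1)) : φ = ψ := by
  ext p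
  exact h p.1 p.2

theorem monomial_mul (n n' : ℤ) (m m' : ℕ) (c c' : K) :
    monomial n m c * monomial n' m' c' = monomial (n + n') (m + m') (c * c') := by
  simp [monomial, AddMonoidAlgebra.single_mul_single]

/-- The defining property of the `q`-derivative with respect to `g`. -/
theorem qDerivG_spec (hq : q ≠ 1) (f : PolyXg K) :
    monomial 1 0 (1 - q) * qDerivG q f = f - dilateG q f := by
  have h1 : 1 - q ≠ 0 := sub_ne_zero.mpr hq.symm
  suffices LinearMap.mulLeft K (monomial 1 0 (1 - q)) ∘ₗ qDerivG q = LinearMap.id - dilateG q from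
    LinearMap.congr_fun this f
  refine linearMap_ext fun n m => ?_
  simp only [LinearMap.comp_apply, qDerivG, dilateG, extend_monomial, one_smul,
    LinearMap.mulLeft_apply, monomial_mul, LinearMap.sub_apply, LinearMap.id_apply]
  rw [mul_div_cancel₀ _ h1, zero_add, add_sub_cancel]
  simp [monomial]

/-- The defining property of the `q`-derivative with respect to `X`. -/
theorem qDerivX_spec (hq : q ≠ 1) (f : PolyXg K) :
    monomial 0 1 (1 - q) * qDerivX q f = f - dilateX q f := by
  have h1 : 1 - q ≠ 0 := sub_ne_zero.mpr hq.symm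
  suffices LinearMap.mulLeft K (monomial 0 1 (1 - q)) ∘ₗ qDerivX q = LinearMap.id - dilateX q from
    LinearMap.congr_fun this f
  refine linearMap_ext fun n m => ?_
  simp only [LinearMap.comp_apply, qDerivX, dilateX, extend_monomial, one_smul,
    LinearMap.mulLeft_apply, monomial_mul, LinearMap.sub_apply, LinearMap.id_apply]
  rw [mul_div_cancel₀ _ h1, zero_add]
  cases m with
  | zero => simp [monomial]
  | succ m => simp [monomial, add_comm]

end PolyXg

/-! Write u = (dg) g⁻¹ and v = dX - u X (`formG`, `formX`). Both forms are right invariant and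
together they generate Γ as a bimodule. On right invariant forms A acts by the adjoint operators G ω
= g ω g⁻¹ and N ω = X ω - g ω g⁻¹ X (`conjG`, `adX`). The relation X g = q g X gives N G = q G N
and, after differentiation, N u = q G v - v.

The left coaction becomes usable once its A-leg is contracted with matrix entries of the
representation g ↦ diag(1, q), X ↦ E₁₂. The lower diagonal entry gives T (`twist`), the corner entry
D (`skewDeriv`). They satisfy T u = u, T v = q v, D u = 0, D v = -u, and T G = G T, T N = q N T, D G
= q⁻¹ G D, D N = N D + T - G.

In dimension 2 the eigenvalues of T decide everything. If u were 0, then v, N v, N² v would have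
weights q, q², q³. So N² v = 0 for lack of room, then D forces N v = 0, and v alone would generate
all right invariant forms (`formG_ne_zero`). Hence u ≠ 0, so v ≠ 0 by D v = -u, and u, v form a
basis with weights 1, q. Weights make G diagonal and kill N v; applying D to N v and N u then fixes
the eigenvalues: G u = q u, G v = v, N u = (q - 1) v (`isStandard`).

These relations make d inner, (q - 1) da = a u - u a (`smul_d_eq`), from which the commutation
relations and the q-derivative formula are computed. Right invariant forms independent over K are
independent over A (`eq_zero_of_sum_op_smul_eq_zero`), so Γ is free as a right module on u, v, with
left action and differential prescribed: this is uniqueness. Existence comes from putting that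
structure on A², with explicit coactions. For coirreducibility, the relations pass to a quotient: if
the image of u vanishes, so does that of v, and the quotient is 0; otherwise the images are again
free generators and the map is injective. -/

open MulOpposite

/-! ### Generators of a calculus and the actions of `A ⊗ A` -/

namespace FirstOrderCalculus

variable {K : Type u} {A : Type v} [Field K] [Ring A] [Algebra K A]
  (Γ : FirstOrderCalculus.{u, v, w} K A)

theorem induction_smul_d {P : Γ.carrier → Prop} (smul_d : ∀ a b : A, P (a • Γ.d b))
    (add : ∀ x y, P x → P y → P (x + y)) (x : Γ.carrier) : P x := by
  have hx : x ∈ Submodule.span A (Set.range Γ.d) := Γ.span_d ▸ Submodule.mem_top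
  -- `P` is not assumed stable under the left action; proving it for all left multiples at once
  -- absorbs the scalar case of the span induction.
  suffices ∀ c : A, P (c • x) by simpa using this 1
  induction hx using Submodule.span_induction with
  | mem x hx =>
    obtain ⟨b, rfl⟩ := hx
    exact fun c => smul_d c b
  | zero =>
    intro c
    simpa using smul_d 0 0
  | add x y _ _ hx hy =>
    intro c
    rw [smul_add]
    exact add _ _ (hx c) (hy c)
  | smul a x _ hx =>
    intro c
    rw [smul_smul]
    exact hx _

theorem d_one : Γ.d 1 = 0 := by
  simpa using Γ.leibniz 1 1

/-- The Leibniz rule turns right multiples of generators into left combinations of generators, so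
that maps known only on the `a • d b` can be tested against the right action. -/
theorem op_smul_smul_d (a b c : A) :
    op c • a • Γ.d b = a • Γ.d (b * c) - (a * b) • Γ.d c := by
  rw [Γ.leibniz, smul_add, smul_smul, ← smul_comm a (op c)]
  abel

theorem smul_op_smul (a b : A) (x : Γ.carrier) : a • op b • x = op b • a • x :=
  smul_comm _ _ _

/-- The right action of `A ⊗ A` on `Γ ⊗ A`. -/
noncomputable def opSMulRight :
    A ⊗[K] A →ₗ[K] Γ.carrier ⊗[K] A →ₗ[K] Γ.carrier ⊗[K] A :=
  TensorProduct.map₂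
    ((Algebra.lsmul K K Γ.carrier).toLinearMap ∘ₗ (opLinearEquiv K).toLinearMap)
    (LinearMap.mul K A).flip

@[simp] theorem opSMulRight_tmul (a b c : A) (x : Γ.carrier) :
    Γ.opSMulRight (a ⊗ₜ b) (x ⊗ₜ c) = (op a • x) ⊗ₜ (c * b) := by
  simp [opSMulRight]

@[simp] theorem smulRight_tmul (a b c : A) (x : Γ.carrier) :
    Γ.smulRight (a ⊗ₜ b) (x ⊗ₜ c) = (a • x) ⊗ₜ (b * c) := by
  simp [smulRight]

@[simp] theorem smulLeft_tmul (a b c : A) (x : Γ.carrier) :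
    Γ.smulLeft (a ⊗ₜ b) (c ⊗ₜ x) = (a * c) ⊗ₜ (b • x) := by
  simp [smulLeft]

theorem smulRight_mul (s t : A ⊗[K] A) (z : Γ.carrier ⊗[K] A) :
    Γ.smulRight (s * t) z = Γ.smulRight s (Γ.smulRight t z) := by
  induction z with
  | zero => simp
  | add y z hy hz => simp only [map_add, hy, hz]
  | tmul x c =>
    induction s with
    | zero => simp
    | add s s' h h' => simp only [add_mul, map_add, LinearMap.add_apply, h, h']
    | tmul a b =>
      induction t with
      | zero => simp
      | add s s' h h' => simp only [mul_add, map_add, LinearMap.add_apply, h, h']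
      | tmul a' b' => simp [mul_smul, mul_assoc]

theorem smulLeft_mul (s t : A ⊗[K] A) (z : A ⊗[K] Γ.carrier) :
    Γ.smulLeft (s * t) z = Γ.smulLeft s (Γ.smulLeft t z) := by
  induction z with
  | zero => simp
  | add y z hy hz => simp only [map_add, hy, hz]
  | tmul x c =>
    induction s with
    | zero => simp
    | add s s' h h' => simp only [add_mul, map_add, LinearMap.add_apply, h, h']
    | tmul a b =>
      induction t with
      | zero => simp
      | add s s' h h' => simp only [mul_add, map_add, LinearMap.add_apply, h, h']
      | tmul a' b' => simp [mul_smul, mul_assoc]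

theorem opSMulRight_smulRight (s t : A ⊗[K] A) (z : Γ.carrier ⊗[K] A) :
    Γ.opSMulRight t (Γ.smulRight s z) = Γ.smulRight s (Γ.opSMulRight t z) := by
  induction z with
  | zero => simp
  | add y z hy hz => simp only [map_add, hy, hz]
  | tmul x c =>
    induction s with
    | zero => simp
    | add s s' h h' => simp only [map_add, LinearMap.add_apply, h, h']
    | tmul a b =>
      induction t with
      | zero => simp
      | add s s' h h' => simp only [map_add, LinearMap.add_apply, h, h']
      | tmul a' b' => simp [smul_op_smul, mul_assoc]

/-- Leibniz rule for `d ⊗ id` over `A ⊗ A`; this is what makes the right coaction compatible with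
right multiplication. -/
theorem rTensor_d_mul (s t : A ⊗[K] A) :
    Γ.d.rTensor A (s * t) =
      Γ.smulRight s (Γ.d.rTensor A t) + Γ.opSMulRight t (Γ.d.rTensor A s) := by
  induction s with
  | zero => simp
  | add s s' h h' => simp only [add_mul, map_add, LinearMap.add_apply, h, h']; abel
  | tmul a b =>
    induction t with
    | zero => simp
    | add s s' h h' => simp only [mul_add, map_add, LinearMap.add_apply, h, h']; abel
    | tmul a' b' => simp [Γ.leibniz, TensorProduct.add_tmul]

end FirstOrderCalculus

/-! ### Compatibility of the coactions with the bimodule structure -/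

namespace BicovariantCalculus

variable {K : Type u} {A : Type v} [Field K] [Ring A]

section Bialgebra

variable [Bialgebra K A] (Γ : BicovariantCalculus.{u, v, w} K A)

theorem coactR_smul (a : A) (x : Γ.carrier) :
    Γ.coactR (a • x) = Γ.smulRight (Coalgebra.comul (R := K) a) (Γ.coactR x) := by
  induction x using Γ.toFirstOrderCalculus.induction_smul_d with
  | smul_d b c =>
    rw [smul_smul, Γ.coactR_smul_d, Γ.coactR_smul_d, Bialgebra.comul_mul, Γ.smulRight_mul]
  | add x y hx hy => rw [smul_add, map_add, map_add, map_add, hx, hy]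

theorem coactR_op_smul (a : A) (x : Γ.carrier) :
    Γ.coactR (op a • x) = Γ.opSMulRight (Coalgebra.comul (R := K) a) (Γ.coactR x) := by
  induction x using Γ.toFirstOrderCalculus.induction_smul_d with
  | smul_d b c =>
    rw [Γ.op_smul_smul_d, map_sub, Γ.coactR_smul_d, Γ.coactR_smul_d, Γ.coactR_smul_d,
      Bialgebra.comul_mul, Bialgebra.comul_mul, Γ.rTensor_d_mul, map_add, Γ.smulRight_mul,
      Γ.opSMulRight_smulRight]
    abel
  | add x y hx hy => rw [smul_add, map_add, map_add, map_add, hx, hy]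

theorem coactR_d (a : A) :
    Γ.coactR (Γ.d a) = Γ.d.rTensor A (Coalgebra.comul (R := K) a) := by
  have h := Γ.coactR_smul_d 1 a
  rw [one_smul, Bialgebra.comul_one] at h
  rw [h]
  induction Coalgebra.comul (R := K) a with
  | zero => simp
  | add x y hx hy => simp only [map_add, hx, hy]
  | tmul x y => simp [Algebra.TensorProduct.one_def]

theorem mem_rightInvariants {x : Γ.carrier} :
    x ∈ Γ.rightInvariants ↔ Γ.coactR x = x ⊗ₜ 1 := by
  simp [rightInvariants, sub_eq_zero]

section Coefficients

variable {n : Type*} [Fintype n] [DecidableEq n] (ρ : A →ₐ[K] Matrix n n K)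

/-- The matrix coefficients of a representation, as linear forms. -/
def coeff (i j : n) : A →ₗ[K] K := Matrix.entryLinearMap K K i j ∘ₗ ρ.toLinearMap

theorem coeff_apply (i j : n) (a : A) : coeff ρ i j a = ρ a i j := rfl

/-- The contraction of the coproduct with a matrix coefficient of a representation. -/
noncomputable def comulCoeff (i j : n) : A →ₗ[K] A :=
  (TensorProduct.lid K A).toLinearMap ∘ₗ (coeff ρ i j).rTensor A ∘ₗ Coalgebra.comul

/-- The contraction of the left coaction with a matrix coefficient of a representation. -/
noncomputable def coactCoeff (i j : n) : Γ.carrier →ₗ[K] Γ.carrier :=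
  (TensorProduct.lid K Γ.carrier).toLinearMap ∘ₗ (coeff ρ i j).rTensor Γ.carrier ∘ₗ Γ.coactL

/-- The matrix with entries ρ(a₍₁₎)ᵢⱼ a₍₂₎ is multiplicative in a, because Δ and ρ are. -/
theorem comulCoeff_mul (i j : n) (a b : A) :
    comulCoeff ρ i j (a * b) = ∑ k, comulCoeff ρ i k a * comulCoeff ρ k j b := by
  simp only [comulCoeff, LinearMap.comp_apply, Bialgebra.comul_mul]
  generalize Coalgebra.comul (R := K) a = s
  generalize Coalgebra.comul (R := K) b = t
  induction s with
  | zero => simp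
  | add s s' h h' => simp only [add_mul, map_add, Finset.sum_add_distrib, h, h']
  | tmul a b =>
    induction t with
    | zero => simp
    | add s s' h h' => simp only [mul_add, map_add, Finset.sum_add_distrib, h, h']
    | tmul a' b' =>
      simp [coeff_apply, Matrix.mul_apply, Finset.sum_smul]
      exact Finset.sum_congr rfl fun k _ => by rw [smul_smul, mul_comm]

theorem coactCoeff_smul_d (i j : n) (a b : A) :
    Γ.coactCoeff ρ i j (a • Γ.d b) = ∑ k, comulCoeff ρ i k a • Γ.d (comulCoeff ρ k j b) := by
  simp only [comulCoeff, coactCoeff, LinearMap.comp_apply, Γ.coactL_smul_d]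
  generalize Coalgebra.comul (R := K) a = s
  generalize Coalgebra.comul (R := K) b = t
  induction s with
  | zero => simp
  | add s s' h h' =>
    simp only [add_smul, map_add, LinearMap.add_apply, Finset.sum_add_distrib, h, h']
  | tmul a b =>
    induction t with
    | zero => simp
    | add s s' h h' => simp only [smul_add, map_add, Finset.sum_add_distrib, h, h']
    | tmul a' b' =>
      simp [coeff_apply, Matrix.mul_apply, Finset.sum_smul, mul_smul]
      exact Finset.sum_congr rfl fun k _ => by rw [smul_comm b]

/-- Contracting the left coaction with a representation gives matrices of operators on Γ that
multiply like the matrices of `comulCoeff`. All use of the left coaction in the classification goes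
through this rule and its right-hand analogue. -/
theorem coactCoeff_smul (i j : n) (a : A) (x : Γ.carrier) :
    Γ.coactCoeff ρ i j (a • x) = ∑ k, comulCoeff ρ i k a • Γ.coactCoeff ρ k j x := by
  induction x using Γ.toFirstOrderCalculus.induction_smul_d with
  | smul_d b c =>
    simp only [smul_smul, coactCoeff_smul_d, comulCoeff_mul, Finset.sum_smul, Finset.smul_sum]
    exact Finset.sum_comm
  | add x y hx hy => simp only [smul_add, map_add, hx, hy, Finset.sum_add_distrib]

theorem coactCoeff_op_smul (i j : n) (a : A) (x : Γ.carrier) :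
    Γ.coactCoeff ρ i j (op a • x) = ∑ k, op (comulCoeff ρ k j a) • Γ.coactCoeff ρ i k x := by
  induction x using Γ.toFirstOrderCalculus.induction_smul_d with
  | smul_d b c =>
    simp only [Γ.op_smul_smul_d, map_sub, coactCoeff_smul_d, comulCoeff_mul, Finset.sum_smul,
      Finset.smul_sum, map_sum, Finset.sum_sub_distrib]
    rw [Finset.sum_comm]
  | add x y hx hy => simp only [smul_add, map_add, hx, hy, Finset.sum_add_distrib]

end Coefficients

end Bialgebra

/-! ### Right invariant forms over a Hopf algebra -/

section HopfAlgebra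

variable [HopfAlgebra K A] (Γ : BicovariantCalculus.{u, v, w} K A)

/-- The projection `ω ↦ ω₍₀₎ S(ω₍₁₎)` to the right invariant forms. -/
noncomputable def invariantPart : Γ.carrier →ₗ[K] Γ.carrier :=
  TensorProduct.lift (((Algebra.lsmul K K Γ.carrier).toLinearMap ∘ₗ
    (opLinearEquiv K).toLinearMap ∘ₗ HopfAlgebraStruct.antipode K).flip) ∘ₗ Γ.coactR

variable {Γ} in
-- For invariant x, the coaction of x a is x a₍₁₎ ⊗ a₍₂₎, and x a₍₁₎ S(a₍₂₎) = ε(a) x by the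
-- antipode axiom.
theorem invariantPart_op_smul {x : Γ.carrier} (hx : x ∈ Γ.rightInvariants) (a : A) :
    Γ.invariantPart (op a • x) = Coalgebra.counit (R := K) a • x := by
  have h := congrArg (fun b => op b • x) (HopfAlgebra.mul_antipode_lTensor_comul_apply (R := K) a)
  simp only [Algebra.algebraMap_eq_smul_one, op_smul, op_one, smul_assoc, one_smul] at h
  rw [← h, invariantPart, LinearMap.comp_apply, coactR_op_smul, Γ.mem_rightInvariants.mp hx]
  induction Coalgebra.comul (R := K) a with
  | zero => simp
  | add s t hs ht => simp only [map_add, LinearMap.add_apply, op_add, add_smul, hs, ht]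
  | tmul b c => simp [mul_smul]

variable {Γ} in
/-- Right invariant forms that are linearly independent over `K` are so over `A` on the right. -/
theorem eq_zero_of_sum_op_smul_eq_zero {ι : Type*} [Fintype ι] {x : ι → Γ.carrier}
    (hx : ∀ i, x i ∈ Γ.rightInvariants) (hli : LinearIndependent K x) {a : ι → A}
    (h : ∑ i, op (a i) • x i = 0) (i : ι) : a i = 0 := by
  -- As in the structure theorem for Hopf modules: coacting and then projecting the form leg to its
  -- invariant part recovers the coefficients from x a.
  have key : ∀ i, Γ.invariantPart.rTensor A (Γ.coactR (op (a i) • x i)) = x i ⊗ₜ a i := by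
    intro i
    rw [coactR_op_smul, Γ.mem_rightInvariants.mp (hx i)]
    trans x i ⊗ₜ TensorProduct.lid K A
      ((Coalgebra.counit (R := K)).rTensor A (Coalgebra.comul (R := K) (a i)))
    · induction Coalgebra.comul (R := K) (a i) with
      | zero => simp
      | add s t hs ht =>
        simp only [map_add, LinearMap.add_apply, TensorProduct.tmul_add, hs, ht]
      | tmul b c => simp [invariantPart_op_smul (hx i), TensorProduct.smul_tmul]
    · simp
  have h' := congrArg (fun y => Γ.invariantPart.rTensor A (Γ.coactR y)) h
  simp only [map_sum, key, map_zero] at h'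
  classical
  -- A linear form dual to `x i`, extended from the span of the family to all of Γ; applied to the
  -- form leg it isolates `a i`.
  obtain ⟨f, hf⟩ := LinearMap.exists_extend (Finsupp.lapply i ∘ₗ hli.repr)
  have hfx : ∀ j, f (x j) = if j = i then 1 else 0 := by
    intro j
    have := LinearMap.congr_fun hf ⟨x j, Submodule.subset_span ⟨j, rfl⟩⟩
    rw [LinearMap.comp_apply, Submodule.subtype_apply] at this
    rw [this, LinearMap.comp_apply, hli.repr_eq_single j _ rfl, Finsupp.lapply_apply,
      Finsupp.single_apply]
  simpa [hfx] using congrArg (fun y => TensorProduct.lid K A (f.rTensor A y)) h'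

end HopfAlgebra

end BicovariantCalculus

/-! ### Invariant forms and adjoint operators on calculi over `CqB q` -/

namespace CqB

variable {K : Type u} [Field K] {q : K}

section Calculus

variable (Γ : FirstOrderCalculus.{u, u, w} K (CqB q))

/-- The right invariant form `(dg) g⁻¹`. -/
noncomputable def formG : Γ.carrier := op (gInv q) • Γ.d (g q)

/-- The right invariant form `dX - (dg) g⁻¹ X`. -/
noncomputable def formX : Γ.carrier := Γ.d (X q) - op (X q) • formG Γ

/-- The action `ω ↦ g ω g⁻¹`. -/
noncomputable def conjG : Γ.carrier →ₗ[K] Γ.carrier :=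
  Algebra.lsmul K K Γ.carrier (g q) ∘ₗ Algebra.lsmul K K Γ.carrier (op (gInv q))

/-- The action `ω ↦ X ω - g ω g⁻¹ X`. -/
noncomputable def adX : Γ.carrier →ₗ[K] Γ.carrier :=
  Algebra.lsmul K K Γ.carrier (X q) - Algebra.lsmul K K Γ.carrier (op (X q)) ∘ₗ conjG Γ

variable {Γ}

theorem conjG_apply (x : Γ.carrier) : conjG Γ x = g q • op (gInv q) • x := rfl

theorem adX_apply (x : Γ.carrier) : adX Γ x = X q • x - op (X q) • conjG Γ x := rfl

@[simp] theorem op_g_op_gInv (x : Γ.carrier) : op (g q) • op (gInv q) • x = x := by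
  rw [smul_smul, ← op_mul, gInv_mul_g, op_one, one_smul]

@[simp] theorem op_gInv_op_g (x : Γ.carrier) : op (gInv q) • op (g q) • x = x := by
  rw [smul_smul, ← op_mul, g_mul_gInv, op_one, one_smul]

@[simp] theorem g_smul_gInv_smul (x : Γ.carrier) : g q • gInv q • x = x := by
  rw [smul_smul, g_mul_gInv, one_smul]

@[simp] theorem gInv_smul_g_smul (x : Γ.carrier) : gInv q • g q • x = x := by
  rw [smul_smul, gInv_mul_g, one_smul]

theorem op_g_op_X (x : Γ.carrier) : op (g q) • op (X q) • x = q • op (X q) • op (g q) • x := by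
  rw [smul_smul, smul_smul, ← op_mul, ← op_mul, X_mul_g, op_smul, smul_assoc]

theorem X_smul_g_smul (x : Γ.carrier) : X q • g q • x = q • g q • X q • x := by
  rw [smul_smul, smul_smul, X_mul_g, smul_assoc]

theorem op_X_op_gInv (x : Γ.carrier) :
    op (X q) • op (gInv q) • x = q • op (gInv q) • op (X q) • x := by
  rw [smul_smul, smul_smul, ← op_mul, ← op_mul, gInv_mul_X, op_smul, smul_assoc]

theorem d_g : Γ.d (g q) = op (g q) • formG Γ := by
  simp [formG]

theorem d_X : Γ.d (X q) = formX Γ + op (X q) • formG Γ := by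
  simp [formX]

theorem d_gInv : Γ.d (gInv q) = -(gInv q • op (gInv q) • Γ.d (g q)) := by
  have h := Γ.leibniz (g q) (gInv q)
  rw [g_mul_gInv, Γ.d_one] at h
  have h' := congrArg (gInv q • ·) h
  simp only [smul_zero, smul_add, gInv_smul_g_smul] at h'
  exact eq_neg_of_add_eq_zero_left h'.symm

theorem adX_conjG (x : Γ.carrier) : adX Γ (conjG Γ x) = q • conjG Γ (adX Γ x) := by
  simp only [adX_apply, conjG_apply, smul_sub, X_smul_g_smul,
    op_X_op_gInv, ← smul_comm (g q) (op (X q)), ← smul_comm (g q) (op (gInv q)),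
    ← smul_comm (X q) (op (gInv q)), smul_comm _ q]

/-- Apply d to X g = q g X, multiply on the right by g⁻¹, and rewrite dX in terms of the two
invariant forms. -/
theorem adX_formG : adX Γ (formG Γ) = q • conjG Γ (formX Γ) - formX Γ := by
  have h := congrArg Γ.d (X_mul_g q)
  rw [map_smul, Γ.leibniz, Γ.leibniz] at h
  have h' := congrArg (op (gInv q) • ·) h
  simp only [smul_add, smul_comm _ q, op_gInv_op_g] at h'
  rw [← op_X_op_gInv, ← smul_comm (X q), ← smul_comm (g q)] at h'
  have e : q • g q • op (gInv q) • op (X q) • formG Γ =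
      op (X q) • g q • op (gInv q) • formG Γ := by
    rw [smul_comm q, ← op_X_op_gInv, smul_comm (g q)]
  rw [adX_apply, conjG_apply, conjG_apply, ← e]
  simp only [formX, smul_sub]
  change X q • formG Γ + Γ.d (X q) = q • g q • op (gInv q) • Γ.d (X q) + op (X q) • formG Γ at h'
  rw [eq_sub_of_add_eq h']
  abel

theorem g_smul_of_conjG {x : Γ.carrier} {c : K} (h : conjG Γ x = c • x) :
    g q • x = c • op (g q) • x := by
  rw [smul_comm c, ← h, conjG_apply, ← smul_comm (g q), op_g_op_gInv]

theorem gInv_smul_of_g_smul {x : Γ.carrier} {c : K} (hc : c ≠ 0)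
    (h : g q • x = c • op (g q) • x) : gInv q • x = c⁻¹ • op (gInv q) • x := by
  have h' := congrArg (fun y => gInv q • op (gInv q) • y) h
  simp only [smul_comm _ c, op_gInv_op_g, ← smul_comm (g q) (op (gInv q)),
    gInv_smul_g_smul] at h'
  rw [h', inv_smul_smul₀ hc]

/-- The generators of A suffice: stability under them gives stability under A on the left, and then
the Leibniz rule puts every `d a` in `S`, the case of g⁻¹ being reduced to dg. -/
theorem mem_of_generators {S : AddSubgroup Γ.carrier} (hop : ∀ a : CqB q, ∀ x ∈ S, op a • x ∈ S)
    (hg : ∀ x ∈ S, g q • x ∈ S) (hi : ∀ x ∈ S, gInv q • x ∈ S) (hX : ∀ x ∈ S, X q • x ∈ S)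
    (hdg : Γ.d (g q) ∈ S) (hdX : Γ.d (X q) ∈ S) (x : Γ.carrier) : x ∈ S := by
  have hsmul : ∀ a : CqB q, ∀ x ∈ S, a • x ∈ S := by
    intro a
    induction a using CqB.induction with
    | hs c =>
      intro x hx
      rw [algebraMap_smul, ← algebraMap_smul (CqB q)ᵐᵒᵖ c x]
      exact hop _ _ hx
    | hX => exact hX
    | hg => exact hg
    | hi => exact hi
    | hm a b ha hb =>
      intro x hx
      rw [mul_smul]
      exact ha _ (hb _ hx)
    | ha a b ha hb =>
      intro x hx
      rw [add_smul]
      exact S.add_mem (ha _ hx) (hb _ hx)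
  have hd : ∀ a : CqB q, Γ.d a ∈ S := by
    intro a
    induction a using CqB.induction with
    | hs c =>
      rw [Algebra.algebraMap_eq_smul_one, map_smul, Γ.d_one, smul_zero]
      exact S.zero_mem
    | hX => exact hdX
    | hg => exact hdg
    | hi =>
      rw [d_gInv]
      exact S.neg_mem (hi _ (hop _ _ hdg))
    | hm a b ha hb =>
      rw [Γ.leibniz]
      exact S.add_mem (hsmul _ _ hb) (hop _ _ ha)
    | ha a b ha hb =>
      rw [map_add]
      exact S.add_mem ha hb
  induction x using Γ.induction_smul_d with
  | smul_d a b => exact hsmul _ _ (hd _)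
  | add x y hx hy => exact S.add_mem hx hy

/-- The relations move g and X past the two forms, so the right submodule generated by these is a
sub-bimodule. That `l` and `m` are nonzero is needed to move g⁻¹. The scalars stay free so that the
lemma also serves the degenerate case of `formG_ne_zero`. -/
theorem exists_eq_op_smul_add {l m c : K} (hl : l ≠ 0) (hm : m ≠ 0)
    (hgu : g q • formG Γ = l • op (g q) • formG Γ) (hgv : g q • formX Γ = m • op (g q) • formX Γ)
    (hXu : X q • formG Γ = l • op (X q) • formG Γ + c • formX Γ)
    (hXv : X q • formX Γ = m • op (X q) • formX Γ) (x : Γ.carrier) :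
    ∃ a b : CqB q, x = op a • formG Γ + op b • formX Γ := by
  let S : AddSubgroup Γ.carrier :=
    { carrier := {x | ∃ a b : CqB q, x = op a • formG Γ + op b • formX Γ}
      zero_mem' := ⟨0, 0, by simp⟩
      add_mem' := by
        rintro _ _ ⟨a, b, rfl⟩ ⟨a', b', rfl⟩
        exact ⟨a + a', b + b', by simp only [op_add, add_smul]; abel⟩
      neg_mem' := by
        rintro _ ⟨a, b, rfl⟩
        exact ⟨-a, -b, by simp only [op_neg, neg_smul]; abel⟩ }
  refine mem_of_generators (S := S) ?_ ?_ ?_ ?_ ⟨g q, 0, by simp [d_g]⟩ ⟨X q, 1, ?_⟩ x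
  · rintro c _ ⟨a, b, rfl⟩
    exact ⟨a * c, b * c, by simp only [op_mul, mul_smul, smul_add]⟩
  · rintro _ ⟨a, b, rfl⟩
    refine ⟨l • (g q * a), m • (g q * b), ?_⟩
    simp only [smul_add, op_smul, op_mul, smul_assoc, mul_smul, smul_comm (g q) (op _), hgu, hgv]
    simp only [smul_comm _ l, smul_comm _ m]
  · rintro _ ⟨a, b, rfl⟩
    refine ⟨l⁻¹ • (gInv q * a), m⁻¹ • (gInv q * b), ?_⟩
    simp only [smul_add, op_smul, op_mul, smul_assoc, mul_smul, smul_comm (gInv q) (op _),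
      gInv_smul_of_g_smul hl hgu, gInv_smul_of_g_smul hm hgv]
    simp only [smul_comm _ l⁻¹, smul_comm _ m⁻¹]
  · rintro _ ⟨a, b, rfl⟩
    refine ⟨l • (X q * a), c • a + m • (X q * b), ?_⟩
    simp only [smul_add, op_smul, op_add, op_mul, smul_assoc, mul_smul, add_smul,
      smul_comm (X q) (op _), hXu, hXv]
    simp only [smul_comm _ l, smul_comm _ m, smul_comm _ c]
    abel
  · rw [d_X, op_one, one_smul, add_comm]

end Calculus

/-! ### The two-dimensional representation and its operators on one-forms -/

/-- The representation `g ↦ diag(1, q)`, `X ↦ E₁₂`. -/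
noncomputable def rep (hq0 : q ≠ 0) : CqB q →ₐ[K] Matrix (Fin 2) (Fin 2) K :=
  lift !![0, 1; 0, 0] !![1, 0; 0, q] !![1, 0; 0, q⁻¹]
    (by simp [hq0, Matrix.one_fin_two]) (by simp [hq0, Matrix.one_fin_two])
    (by ext i j; fin_cases i <;> fin_cases j <;> simp)

section Rep

open BicovariantCalculus

variable (hq0 : q ≠ 0)

theorem rep_X : rep hq0 (X q) = !![0, 1; 0, 0] := lift_X _ _ _ _ _ _

theorem rep_g : rep hq0 (g q) = !![1, 0; 0, q] := lift_g _ _ _ _ _ _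

theorem rep_gInv : rep hq0 (gInv q) = !![1, 0; 0, q⁻¹] := lift_gInv _ _ _ _ _ _

/-- The representation is upper triangular with the counit in the corner (0, 0). So among the four
contracted operators one is zero, one is the identity, and only `twist` and `skewDeriv` carry
information. -/
theorem rep_apply_one_zero (a : CqB q) : rep hq0 a 1 0 = 0 := by
  induction a using CqB.induction with
  | hs c => simp [Matrix.algebraMap_matrix_apply]
  | hX => simp [rep_X]
  | hg => simp [rep_g]
  | hi => simp [rep_gInv]
  | hm a b ha hb => simp [Matrix.mul_apply, ha, hb]
  | ha a b ha hb => simp [ha, hb]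

theorem rep_apply_zero_zero (a : CqB q) : rep hq0 a 0 0 = Coalgebra.counit (R := K) a := by
  induction a using CqB.induction with
  | hs c => simp [Matrix.algebraMap_matrix_apply]
  | hX => simp [rep_X, counit_X]
  | hg => simp [rep_g, counit_g]
  | hi => simp [rep_gInv, counit_gInv]
  | hm a b ha hb => simp [Matrix.mul_apply, ha, hb, rep_apply_one_zero]
  | ha a b ha hb => simp [ha, hb]

theorem comulCoeff_X (i j : Fin 2) : comulCoeff (rep hq0) i j (X q) =
    rep hq0 (X q) i j • (1 : CqB q) + rep hq0 (g q) i j • X q := by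
  simp [comulCoeff, comul_X, coeff_apply]

theorem comulCoeff_g (i j : Fin 2) :
    comulCoeff (rep hq0) i j (g q) = rep hq0 (g q) i j • g q := by
  simp [comulCoeff, comul_g, coeff_apply]

theorem comulCoeff_gInv (i j : Fin 2) :
    comulCoeff (rep hq0) i j (gInv q) = rep hq0 (gInv q) i j • gInv q := by
  simp [comulCoeff, comul_gInv, coeff_apply]

theorem comulCoeff_one_zero (a : CqB q) : comulCoeff (rep hq0) 1 0 a = 0 := by
  have : coeff (rep hq0) 1 0 = 0 := LinearMap.ext (rep_apply_one_zero hq0)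
  simp [comulCoeff, this]

theorem comulCoeff_zero_zero (a : CqB q) : comulCoeff (rep hq0) 0 0 a = a := by
  have : coeff (rep hq0) 0 0 = Coalgebra.counit (R := K) :=
    LinearMap.ext (rep_apply_zero_zero hq0)
  simp [comulCoeff, this]

end Rep

section Twist

variable (Γ : BicovariantCalculus.{u, u, w} K (CqB q)) (hq0 : q ≠ 0)

/-- The operator on one-forms induced by the automorphism `g ↦ q g`, `X ↦ q X`. -/
noncomputable def twist : Γ.carrier →ₗ[K] Γ.carrier := Γ.coactCoeff (rep hq0) 1 1

/-- The skew derivation of one-forms induced by `g ↦ 0`, `X ↦ 1`. -/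
noncomputable def skewDeriv : Γ.carrier →ₗ[K] Γ.carrier := Γ.coactCoeff (rep hq0) 0 1

theorem coactCoeff_one_zero (x : Γ.carrier) : Γ.coactCoeff (rep hq0) 1 0 x = 0 := by
  induction x using Γ.toFirstOrderCalculus.induction_smul_d with
  | smul_d a b =>
    simp [Γ.coactCoeff_smul_d, Fin.sum_univ_two, comulCoeff_one_zero]
  | add x y hx hy => rw [map_add, hx, hy, add_zero]

theorem coactCoeff_zero_zero (x : Γ.carrier) : Γ.coactCoeff (rep hq0) 0 0 x = x := by
  induction x using Γ.toFirstOrderCalculus.induction_smul_d with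
  | smul_d a b =>
    simp [Γ.coactCoeff_smul_d, Fin.sum_univ_two, comulCoeff_one_zero, comulCoeff_zero_zero]
  | add x y hx hy => rw [map_add, hx, hy]

theorem coactCoeff_d (i j : Fin 2) (a : CqB q) : Γ.coactCoeff (rep hq0) i j (Γ.d a) =
    Γ.d (BicovariantCalculus.comulCoeff (rep hq0) i j a) := by
  have h1 : ∀ i j, BicovariantCalculus.comulCoeff (rep hq0) i j 1 =
      if i = j then 1 else 0 := by
    intro i j
    simp [BicovariantCalculus.comulCoeff, BicovariantCalculus.coeff_apply, Matrix.one_apply,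
      Algebra.TensorProduct.one_def]
  have h := Γ.coactCoeff_smul_d (rep hq0) i j 1 a
  simpa [h1] using h

variable (x : Γ.carrier)

theorem twist_g_smul : twist Γ hq0 (g q • x) = q • g q • twist Γ hq0 x := by
  simp [twist, Γ.coactCoeff_smul, comulCoeff_g, rep_g]

theorem twist_X_smul : twist Γ hq0 (X q • x) = q • X q • twist Γ hq0 x := by
  simp [twist, Γ.coactCoeff_smul, comulCoeff_X, rep_g, rep_X]

theorem twist_op_X_smul : twist Γ hq0 (op (X q) • x) = q • op (X q) • twist Γ hq0 x := by
  simp [twist, Γ.coactCoeff_op_smul, comulCoeff_X, rep_g, rep_X, coactCoeff_one_zero]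

theorem twist_op_gInv_smul :
    twist Γ hq0 (op (gInv q) • x) = q⁻¹ • op (gInv q) • twist Γ hq0 x := by
  simp [twist, Γ.coactCoeff_op_smul, comulCoeff_gInv, rep_gInv]

theorem skewDeriv_g_smul : skewDeriv Γ hq0 (g q • x) = g q • skewDeriv Γ hq0 x := by
  simp [skewDeriv, Γ.coactCoeff_smul, comulCoeff_g, rep_g]

theorem skewDeriv_X_smul :
    skewDeriv Γ hq0 (X q • x) = X q • skewDeriv Γ hq0 x + twist Γ hq0 x := by
  simp [skewDeriv, twist, Γ.coactCoeff_smul, comulCoeff_X, rep_g, rep_X]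

theorem skewDeriv_op_X_smul :
    skewDeriv Γ hq0 (op (X q) • x) = q • op (X q) • skewDeriv Γ hq0 x + x := by
  simp [skewDeriv, Γ.coactCoeff_op_smul, comulCoeff_X, rep_g, rep_X, coactCoeff_zero_zero,
    add_comm]

theorem skewDeriv_op_gInv_smul :
    skewDeriv Γ hq0 (op (gInv q) • x) = q⁻¹ • op (gInv q) • skewDeriv Γ hq0 x := by
  simp [skewDeriv, Γ.coactCoeff_op_smul, comulCoeff_gInv, rep_gInv]

/-- With the next three lemmas this gives the action on the invariant forms: weights 1 and q for
`twist`, while `skewDeriv` sends `formX` to `-formG` and kills `formG`. -/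
theorem twist_formG :
    twist Γ hq0 (formG Γ.toFirstOrderCalculus) = formG Γ.toFirstOrderCalculus := by
  rw [formG, twist_op_gInv_smul, twist, coactCoeff_d, comulCoeff_g]
  simp [rep_g, hq0, smul_comm _ q]

theorem twist_formX :
    twist Γ hq0 (formX Γ.toFirstOrderCalculus) = q • formX Γ.toFirstOrderCalculus := by
  rw [formX, map_sub, twist_op_X_smul, twist_formG, twist, coactCoeff_d, comulCoeff_X]
  simp [rep_g, rep_X, smul_sub]

theorem skewDeriv_formG : skewDeriv Γ hq0 (formG Γ.toFirstOrderCalculus) = 0 := by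
  rw [formG, skewDeriv_op_gInv_smul, skewDeriv, coactCoeff_d, comulCoeff_g]
  simp [rep_g]

theorem skewDeriv_formX :
    skewDeriv Γ hq0 (formX Γ.toFirstOrderCalculus) = -formG Γ.toFirstOrderCalculus := by
  rw [formX, map_sub, skewDeriv_op_X_smul, skewDeriv_formG, skewDeriv, coactCoeff_d, comulCoeff_X]
  simp [rep_g, rep_X, Γ.d_one]

theorem twist_conjG : twist Γ hq0 (conjG Γ.toFirstOrderCalculus x) =
    conjG Γ.toFirstOrderCalculus (twist Γ hq0 x) := by
  rw [conjG_apply, conjG_apply, twist_g_smul, twist_op_gInv_smul, smul_comm (g q) q⁻¹,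
    smul_inv_smul₀ hq0]

theorem twist_adX : twist Γ hq0 (adX Γ.toFirstOrderCalculus x) =
    q • adX Γ.toFirstOrderCalculus (twist Γ hq0 x) := by
  rw [adX_apply, adX_apply, map_sub, twist_X_smul, twist_op_X_smul, twist_conjG, smul_sub]

theorem skewDeriv_conjG : skewDeriv Γ hq0 (conjG Γ.toFirstOrderCalculus x) =
    q⁻¹ • conjG Γ.toFirstOrderCalculus (skewDeriv Γ hq0 x) := by
  rw [conjG_apply, conjG_apply, skewDeriv_g_smul, skewDeriv_op_gInv_smul, smul_comm (g q) q⁻¹]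

/-- The lowering operator `skewDeriv` and the raising operator `adX` have commutator T - G, much as
in sl₂. This identity determines the structure constants of the calculus. -/
theorem skewDeriv_adX : skewDeriv Γ hq0 (adX Γ.toFirstOrderCalculus x) =
    adX Γ.toFirstOrderCalculus (skewDeriv Γ hq0 x) + twist Γ hq0 x -
      conjG Γ.toFirstOrderCalculus x := by
  rw [adX_apply, adX_apply, map_sub, skewDeriv_X_smul, skewDeriv_op_X_smul, skewDeriv_conjG,
    smul_comm (op (X q)) q⁻¹, smul_inv_smul₀ hq0]
  abel

end Twist

/-! ### Stability of right invariance under the adjoint operators -/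

section Invariants

variable (Γ : BicovariantCalculus.{u, u, w} K (CqB q))

theorem formG_mem : formG Γ.toFirstOrderCalculus ∈ Γ.rightInvariants := by
  rw [Γ.mem_rightInvariants, formG, Γ.coactR_op_smul, Γ.coactR_d, comul_gInv, comul_g]
  simp [g_mul_gInv]

variable {Γ} in
theorem coactR_op_X_smul {x : Γ.carrier} (hx : x ∈ Γ.rightInvariants) :
    Γ.coactR (op (X q) • x) = (op (X q) • x) ⊗ₜ 1 + (op (g q) • x) ⊗ₜ X q := by
  rw [Γ.coactR_op_smul, Γ.mem_rightInvariants.mp hx, comul_X]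
  simp

theorem formX_mem : formX Γ.toFirstOrderCalculus ∈ Γ.rightInvariants := by
  rw [Γ.mem_rightInvariants, formX, map_sub, coactR_op_X_smul (formG_mem Γ), Γ.coactR_d, comul_X]
  simp [formG, TensorProduct.sub_tmul]

variable {Γ}

theorem conjG_mem {x : Γ.carrier} (hx : x ∈ Γ.rightInvariants) :
    conjG Γ.toFirstOrderCalculus x ∈ Γ.rightInvariants := by
  rw [Γ.mem_rightInvariants, conjG_apply, Γ.coactR_smul, Γ.coactR_op_smul,
    Γ.mem_rightInvariants.mp hx, comul_g, comul_gInv]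
  simp [g_mul_gInv]

/-- The coactions of X x and of g x g⁻¹ X both contain the term g x ⊗ X, which cancels in the
difference. -/
theorem adX_mem {x : Γ.carrier} (hx : x ∈ Γ.rightInvariants) :
    adX Γ.toFirstOrderCalculus x ∈ Γ.rightInvariants := by
  rw [Γ.mem_rightInvariants, adX_apply, map_sub, coactR_op_X_smul (conjG_mem hx),
    Γ.coactR_smul, Γ.mem_rightInvariants.mp hx, comul_X]
  simp [conjG_apply, TensorProduct.sub_tmul, ← smul_comm (g q) (op (g q))]

/-- Right invariant forms in the right submodule generated by `formG` and `formX` are in the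
`K`-span of these. -/
theorem exists_eq_smul_add {x : Γ.carrier} (hx : x ∈ Γ.rightInvariants)
    (h : ∃ a b : CqB q, x = op a • formG Γ.toFirstOrderCalculus +
      op b • formX Γ.toFirstOrderCalculus) :
    ∃ a b : K, x = a • formG Γ.toFirstOrderCalculus + b • formX Γ.toFirstOrderCalculus := by
  obtain ⟨a, b, h⟩ := h
  refine ⟨Coalgebra.counit (R := K) a, Coalgebra.counit (R := K) b, ?_⟩
  have h1 := BicovariantCalculus.invariantPart_op_smul hx 1
  rw [op_one, one_smul, Bialgebra.counit_one, one_smul] at h1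
  rw [← h1, h, map_add, BicovariantCalculus.invariantPart_op_smul (formG_mem Γ),
    BicovariantCalculus.invariantPart_op_smul (formX_mem Γ)]

end Invariants

/-- The commutation relations of the two-dimensional calculus. -/
structure IsStandard (Γ : FirstOrderCalculus.{u, u, w} K (CqB q)) : Prop where
  g_smul_formG : g q • formG Γ = q • op (g q) • formG Γ
  g_smul_formX : g q • formX Γ = op (g q) • formX Γ
  X_smul_formG : X q • formG Γ = q • op (X q) • formG Γ + (q - 1) • formX Γ
  X_smul_formX : X q • formX Γ = op (X q) • formX Γ

theorem formX_ne_zero (hq0 : q ≠ 0) {Γ : BicovariantCalculus.{u, u, w} K (CqB q)}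
    (hu : formG Γ.toFirstOrderCalculus ≠ 0) : formX Γ.toFirstOrderCalculus ≠ 0 := by
  intro h
  have := skewDeriv_formX Γ hq0
  rw [h, map_zero, eq_comm, neg_eq_zero] at this
  exact hu this

/-- The two forms are eigenvectors of `twist` with the distinct eigenvalues 1 and q. No dimension
hypothesis is needed, so this also applies to quotient calculi. -/
theorem linearIndependent_forms (hq0 : q ≠ 0) (hq1 : q ≠ 1)
    {Γ : BicovariantCalculus.{u, u, w} K (CqB q)}
    (hu : formG Γ.toFirstOrderCalculus ≠ 0) :
    LinearIndependent K ![formG Γ.toFirstOrderCalculus, formX Γ.toFirstOrderCalculus] := by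
  refine Module.End.eigenvectors_linearIndependent' (twist Γ hq0) ![1, q] ?_ _ ?_
  · intro i j
    fin_cases i <;> fin_cases j <;> simp [hq1, hq1.symm]
  · intro i
    rw [Module.End.hasEigenvector_iff, Module.End.mem_eigenspace_iff]
    fin_cases i
    · simpa [twist_formG] using hu
    · simpa [twist_formX] using formX_ne_zero hq0 hu

/-! ### Structure constants in dimension two -/

section Classification

variable (hq0 : q ≠ 0) (hq : ∀ n : ℕ, 0 < n → q ^ n ≠ 1)
  (Γ : BicovariantCalculus.{u, u, w} K (CqB q)) (hΓ : Γ.dim = 2)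

include hΓ in
theorem finrank_rightInvariants : Module.finrank K Γ.rightInvariants = 2 :=
  Module.finrank_eq_of_rank_eq hΓ

include hΓ in
theorem card_le_two {n : ℕ} {x : Fin n → Γ.carrier} (hx : ∀ i, x i ∈ Γ.rightInvariants)
    (hli : LinearIndependent K x) : n ≤ 2 := by
  have hf := finrank_rightInvariants Γ hΓ
  have : FiniteDimensional K Γ.rightInvariants := Module.finite_of_finrank_pos (by omega)
  have h := Submodule.finrank_mono (Submodule.span_le.mpr (Set.range_subset_iff.mpr hx))
  rwa [finrank_span_eq_card hli, Fintype.card_fin, hf] at h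

include hΓ in
theorem exists_eq_smul_add_of_dim {u v : Γ.carrier} (hu : u ∈ Γ.rightInvariants)
    (hv : v ∈ Γ.rightInvariants) (hli : LinearIndependent K ![u, v])
    {x : Γ.carrier} (hx : x ∈ Γ.rightInvariants) : ∃ a b : K, x = a • u + b • v := by
  have hf := finrank_rightInvariants Γ hΓ
  have : FiniteDimensional K Γ.rightInvariants := Module.finite_of_finrank_pos (by omega)
  have hle : Submodule.span K (Set.range ![u, v]) ≤ Γ.rightInvariants := by
    rw [Submodule.span_le, Set.range_subset_iff, Fin.forall_fin_two]
    exact ⟨hu, hv⟩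
  have h := Submodule.eq_of_le_of_finrank_eq hle
    (by rw [finrank_span_eq_card hli, Fintype.card_fin, hf])
  rw [← h, Matrix.range_cons, Matrix.range_cons, Matrix.range_empty, Set.union_empty,
    Set.singleton_union, Submodule.mem_span_pair] at hx
  obtain ⟨a, b, hx⟩ := hx
  exact ⟨a, b, hx.symm⟩

include hq0 hq hΓ in
-- If u = 0, then v is a lowest weight vector, D v = 0, and its chain v, N v, N² v has distinct
-- weights. Two dimensions cut the chain off at N² v, and D shows that it must already stop at v,
-- which leaves at most one dimension.
theorem formG_ne_zero : formG Γ.toFirstOrderCalculus ≠ 0 := by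
  intro hu
  have hq1 : q ≠ 1 := by simpa using hq 1
  set v := formX Γ.toFirstOrderCalculus with hv
  set N := adX Γ.toFirstOrderCalculus with hN
  have hGv : conjG Γ.toFirstOrderCalculus v = q⁻¹ • v := by
    have h := adX_formG (Γ := Γ.toFirstOrderCalculus)
    rw [hu, map_zero] at h
    rw [eq_inv_smul_iff₀ hq0]
    exact (sub_eq_zero.mp h.symm)
  have hGNv : conjG Γ.toFirstOrderCalculus (N v) = (q⁻¹ * q⁻¹) • N v := by
    have h := adX_conjG (Γ := Γ.toFirstOrderCalculus) v
    rw [hGv, map_smul] at h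
    rw [mul_smul, eq_inv_smul_iff₀ hq0]
    exact h.symm
  have hTv : twist Γ hq0 v = q • v := twist_formX Γ hq0
  have hTNv : twist Γ hq0 (N v) = q ^ 2 • N v := by
    rw [hN, twist_adX, hTv, map_smul, smul_smul, sq]
  have hTNNv : twist Γ hq0 (N (N v)) = q ^ 3 • N (N v) := by
    rw [hN, twist_adX, hTNv, map_smul, smul_smul, ← pow_succ']
  have hDv : skewDeriv Γ hq0 v = 0 := by
    rw [skewDeriv_formX, hu, neg_zero]
  have hDNv : skewDeriv Γ hq0 (N v) = (q - q⁻¹) • v := by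
    rw [hN, skewDeriv_adX, hDv, map_zero, hTv, hGv, sub_smul, zero_add]
  have hDNNv : skewDeriv Γ hq0 (N (N v)) = (q - q⁻¹ + q ^ 2 - q⁻¹ * q⁻¹) • N v := by
    rw [hN, skewDeriv_adX, hDNv, hTNv, hGNv, map_smul, sub_smul _ (q⁻¹ * q⁻¹), add_smul]
  have hvm : v ∈ Γ.rightInvariants := formX_mem Γ
  -- With N v = 0 the form v generates Γ as a right module, so the right invariant forms lie in the
  -- line of v, against dimension 2.
  have hspan : N v = 0 → False := by
    intro hNv
    -- As `formG` vanishes here, its relations hold with any nonzero `l` and with `c = 0`.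
    have hgen := exists_eq_op_smul_add (Γ := Γ.toFirstOrderCalculus) (l := 1) (m := q⁻¹) (c := 0)
      one_ne_zero (inv_ne_zero hq0) (by simp [hu]) (g_smul_of_conjG hGv) (by simp [hu])
      (by
        have h := adX_apply (Γ := Γ.toFirstOrderCalculus) v
        rw [← hN, hNv, hGv, eq_comm, sub_eq_zero] at h
        rw [← hv, h, smul_comm])
    have hle : Γ.rightInvariants ≤ Submodule.span K {v} := by
      intro x hx
      obtain ⟨a, b, h⟩ := exists_eq_smul_add hx (hgen x)
      rw [hu, smul_zero, zero_add] at h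
      exact Submodule.mem_span_singleton.mpr ⟨b, h.symm⟩
    have h := (Submodule.finrank_mono hle).trans (finrank_span_le_card {v})
    rw [finrank_rightInvariants Γ hΓ] at h
    simp at h
  have hv0 : v ≠ 0 := fun h => hspan (by rw [h, map_zero])
  -- Otherwise v, N v and N² v are right invariant eigenvectors of `twist` for the distinct values
  -- q, q², q³, hence independent.
  have hNNv : N (N v) = 0 := by
    by_contra hNN
    have hli : LinearIndependent K ![v, N v, N (N v)] := by
      refine Module.End.eigenvectors_linearIndependent' (twist Γ hq0) ![q, q ^ 2, q ^ 3] ?_ _ ?_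
      · have h12 : q ≠ q ^ 2 := fun h => hq1 (mul_left_cancel₀ hq0 (by linear_combination -h))
        have h13 : q ≠ q ^ 3 := fun h =>
          hq 2 (by simp) (mul_left_cancel₀ hq0 (by linear_combination -h))
        have h23 : q ^ 2 ≠ q ^ 3 := fun h =>
          hq1 (mul_left_cancel₀ (pow_ne_zero 2 hq0) (by linear_combination -h))
        intro i j
        fin_cases i <;> fin_cases j <;> simp [h12, h13, h23, h12.symm, h13.symm, h23.symm]
      · intro i
        rw [Module.End.hasEigenvector_iff, Module.End.mem_eigenspace_iff]
        fin_cases i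
        · exact ⟨hTv, hv0⟩
        · exact ⟨hTNv, hspan⟩
        · exact ⟨hTNNv, hNN⟩
    have := card_le_two Γ hΓ (x := ![v, N v, N (N v)]) (by
      intro i
      fin_cases i
      · exact hvm
      · exact adX_mem hvm
      · exact adX_mem (adX_mem hvm)) hli
    omega
  rw [hNNv, map_zero, eq_comm, smul_eq_zero] at hDNNv
  refine hDNNv.elim (fun h => ?_) hspan
  -- After multiplication by q² the coefficient of N v is (q² - 1)(q² + q + 1); both factors are
  -- nonzero since q² ≠ 1 and q³ ≠ 1.
  have h2 : q ^ 2 - 1 ≠ 0 := sub_ne_zero.mpr (hq 2 (by simp))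
  have h3 : q ^ 2 + q + 1 ≠ 0 := fun h => hq 3 (by simp) (by linear_combination (q - 1) * h)
  field_simp at h
  exact mul_ne_zero h2 h3 (by linear_combination h)

include hq0 hq hΓ in
-- In the weight basis u, v the operators G and N have few possible entries, and the commutator of D
-- with N, applied to v and then to u, fixes those that remain.
theorem isStandard : IsStandard Γ.toFirstOrderCalculus := by
  have hq1 : q ≠ 1 := by simpa using hq 1
  have hu0 := formG_ne_zero hq0 hq Γ hΓ
  have hv0 := formX_ne_zero hq0 hu0
  have hli := linearIndependent_forms hq0 hq1 hu0
  have hum := formG_mem Γ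
  have hvm := formX_mem Γ
  have hpair := LinearIndependent.pair_iff.mp hli
  set u := formG Γ.toFirstOrderCalculus with hu
  set v := formX Γ.toFirstOrderCalculus with hv
  have hTu : twist Γ hq0 u = u := twist_formG Γ hq0
  have hTv : twist Γ hq0 v = q • v := twist_formX Γ hq0
  have hDu : skewDeriv Γ hq0 u = 0 := skewDeriv_formG Γ hq0
  have hDv : skewDeriv Γ hq0 v = -u := skewDeriv_formX Γ hq0
  have hq1' : q - 1 ≠ 0 := sub_ne_zero.mpr hq1
  have hq2 : q ^ 2 - 1 ≠ 0 := sub_ne_zero.mpr (hq 2 (by simp))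
  obtain ⟨l, b, hGu⟩ := exists_eq_smul_add_of_dim Γ hΓ hum hvm hli (conjG_mem hum)
  obtain ⟨a, m, hGv⟩ := exists_eq_smul_add_of_dim Γ hΓ hum hvm hli (conjG_mem hvm)
  obtain ⟨c, e, hNv⟩ := exists_eq_smul_add_of_dim Γ hΓ hum hvm hli (adX_mem hvm)
  -- `conjG` commutes with `twist`, so it preserves the weight lines; this kills `b` and then `a`.
  obtain rfl : b = 0 := by
    have h := twist_conjG Γ hq0 u
    rw [hTu, hGu, map_add, map_smul, map_smul, hTu, hTv] at h
    have h' := (hpair 0 (b * (q - 1)) (by linear_combination (norm := module) h)).2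
    exact (mul_eq_zero.mp h').resolve_right hq1'
  obtain rfl : a = 0 := by
    have h := twist_conjG Γ hq0 v
    rw [hTv, map_smul, hGv, map_add, map_smul, map_smul, hTu, hTv] at h
    have h' := (hpair (a * (q - 1)) 0 (by linear_combination (norm := module) -h)).1
    exact (mul_eq_zero.mp h').resolve_right hq1'
  -- `adX v` would have weight q², which is neither 1 nor q.
  have hNv0 : adX Γ.toFirstOrderCalculus v = 0 := by
    have h := twist_adX Γ hq0 v
    rw [hTv, map_smul, hNv, map_add, map_smul, map_smul, hTu, hTv] at h
    have h' := hpair (c * (q ^ 2 - 1)) (e * (q * (q - 1)))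
      (by linear_combination (norm := module) -h)
    rw [hNv, (mul_eq_zero.mp h'.1).resolve_right hq2,
      (mul_eq_zero.mp h'.2).resolve_right (mul_ne_zero hq0 hq1')]
    simp
  rw [zero_smul, add_zero] at hGu
  rw [zero_smul, zero_add] at hGv
  have hNu : adX Γ.toFirstOrderCalculus u = (q * m - 1) • v := by
    have h := adX_formG (Γ := Γ.toFirstOrderCalculus)
    rw [← hv, hGv] at h
    rw [hu, h]
    module
  -- `skewDeriv` applied to `adX v = 0` gives (q + 1)(1 - m) v = 0.
  obtain rfl : m = 1 := by
    have h := skewDeriv_adX Γ hq0 v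
    rw [hNv0, map_zero, hDv, map_neg, hNu, hTv, hGv] at h
    have h' := (hpair 0 ((q + 1) * (1 - m)) (by linear_combination (norm := module) -h)).2
    have hq3 : q + 1 ≠ 0 := fun h => hq2 (by linear_combination (q - 1) * h)
    exact (sub_eq_zero.mp ((mul_eq_zero.mp h').resolve_left hq3)).symm
  -- `skewDeriv` applied to `adX u = (q - 1) v` gives -(q - 1) u = (1 - l) u.
  obtain rfl : l = q := by
    have h := skewDeriv_adX Γ hq0 u
    rw [hNu, map_smul, hDv, hDu, map_zero, hTu, hGu] at h
    have h' := (hpair (l - q) 0 (by linear_combination (norm := module) h)).1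
    exact sub_eq_zero.mp h'
  refine ⟨g_smul_of_conjG hGu, ?_, ?_, ?_⟩
  · simpa using g_smul_of_conjG hGv
  · rw [adX_apply, hGu, mul_one, sub_eq_iff_eq_add] at hNu
    rw [hNu, smul_comm, add_comm]
  · rw [adX_apply, hGv, one_smul, sub_eq_zero] at hNv0
    exact hNv0

end Classification

theorem X_mul_gUnit_zpow (hq0 : q ≠ 0) (n : ℤ) :
    X q * ((gUnit q ^ n : (CqB q)ˣ) : CqB q) =
      q ^ n • (((gUnit q ^ n : (CqB q)ˣ) : CqB q) * X q) := by
  have hi : X q * gInv q = q⁻¹ • (gInv q * X q) := by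
    rw [gInv_mul_X, inv_smul_smul₀ hq0]
  induction n using Int.induction_on with
  | zero => simp
  | succ n ih =>
    rw [zpow_add_one, Units.val_mul, ← mul_assoc, ih, smul_mul_assoc, mul_assoc,
      show X q * (gUnit q : CqB q) = _ from X_mul_g q, mul_smul_comm, smul_smul, zpow_add_one₀ hq0,
      mul_assoc]
    rfl
  | pred n ih =>
    rw [zpow_sub_one, Units.val_mul, ← mul_assoc, ih, smul_mul_assoc, mul_assoc,
      show X q * ((gUnit q)⁻¹ : (CqB q)ˣ) = _ from hi, mul_smul_comm, smul_smul,
      zpow_sub_one₀ hq0, mul_assoc]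
    rfl

/-! ### Consequences of the standard relations -/

section Standard

variable {Γ : FirstOrderCalculus.{u, u, w} K (CqB q)}

/-- The map `a ↦ x a`. -/
noncomputable def rightOrbit (x : Γ.carrier) : CqB q →ₗ[K] Γ.carrier :=
  (Algebra.lsmul K K Γ.carrier).toLinearMap.flip x ∘ₗ (opLinearEquiv K).toLinearMap

@[simp] theorem rightOrbit_apply (x : Γ.carrier) (a : CqB q) : rightOrbit x a = op a • x := rfl

theorem gUnit_zpow_smul {x : Γ.carrier} {c : K} (hc : c ≠ 0) (h : g q • x = c • op (g q) • x)
    (n : ℤ) : ((gUnit q ^ n : (CqB q)ˣ) : CqB q) • x =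
      c ^ n • op ((gUnit q ^ n : (CqB q)ˣ) : CqB q) • x := by
  induction n using Int.induction_on with
  | zero => simp
  | succ n ih =>
    rw [zpow_add_one, Units.val_mul, mul_smul, show (gUnit q : CqB q) • x = _ from h, smul_comm _ c,
      smul_comm _ (op (g q)), ih, smul_comm _ (c ^ (n : ℤ)), smul_smul, smul_smul, ← op_mul,
      zpow_add_one₀ hc, mul_comm c]
    rfl
  | pred n ih =>
    rw [zpow_sub_one, Units.val_mul, mul_smul,
      show (((gUnit q)⁻¹ : (CqB q)ˣ) : CqB q) • x = _ from gInv_smul_of_g_smul hc h,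
      smul_comm _ c⁻¹, smul_comm _ (op (gInv q)), ih, smul_comm _ (c ^ (-n : ℤ)), smul_smul,
      smul_smul, ← op_mul, zpow_sub_one₀ hc, mul_comm c⁻¹]
    rfl

namespace IsStandard

variable (h : IsStandard Γ)

include h

/-- Both sides are derivations in `a`, and the relations for `formG` say that they agree at g and X.
So the differential is inner, and is determined by the bimodule and `formG`. -/
theorem smul_d_eq (a : CqB q) : (q - 1) • Γ.d a = a • formG Γ - op a • formG Γ := by
  induction a using CqB.induction with
  | hs c =>
    rw [Algebra.algebraMap_eq_smul_one, map_smul, Γ.d_one, op_smul, op_one, smul_assoc, smul_assoc,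
      one_smul, one_smul, smul_zero, smul_zero, sub_self]
  | hX => rw [d_X, h.X_smul_formG]; generalize op (X q) • formG Γ = y; module
  | hg => rw [d_g, h.g_smul_formG]; generalize op (g q) • formG Γ = y; module
  | hi =>
    have hg : (q - 1) • Γ.d (g q) = g q • formG Γ - op (g q) • formG Γ := by
      rw [d_g, h.g_smul_formG]; generalize op (g q) • formG Γ = y; module
    rw [d_gInv, smul_neg, smul_comm _ (gInv q), smul_comm _ (op (gInv q)), hg, smul_sub, smul_sub,
      op_gInv_op_g, smul_comm (gInv q) (op (gInv q)), gInv_smul_g_smul]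
    abel
  | hm a b ha hb =>
    rw [Γ.leibniz, smul_add, smul_comm _ a, smul_comm _ (op b), ha, hb, smul_sub, smul_sub,
      mul_smul, op_mul, mul_smul, ← smul_comm a (op b)]
    abel
  | ha a b ha hb =>
    rw [map_add, smul_add, ha, hb, op_add, add_smul, add_smul]
    abel

theorem X_pow_smul_formG (m : ℕ) : X q ^ (m + 1) • formG Γ =
    q ^ (m + 1) • op (X q ^ (m + 1)) • formG Γ + (q ^ (m + 1) - 1) • op (X q ^ m) • formX Γ := by
  induction m with
  | zero => simp [h.X_smul_formG]
  | succ m ih =>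
    rw [pow_succ' (X q) (m + 1), mul_smul, ih, smul_add, smul_comm (X q) (q ^ (m + 1)),
      smul_comm (X q) (_ - _), smul_comm (X q) (op _), smul_comm (X q) (op _), h.X_smul_formX,
      h.X_smul_formG, smul_add, smul_comm (op _) q, smul_smul (op (X q ^ (m + 1))), ← op_mul,
      smul_smul (op (X q ^ m)), ← op_mul, ← pow_succ' (X q) m, smul_comm (op _) (q - 1)]
    generalize op (_ : CqB q) • formG Γ = y
    generalize op (_ : CqB q) • formX Γ = z
    module

/-- On a monomial gⁿ Xᵐ, multiplication by q - 1 replaces d by the commutator with `formG`. Moving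
gⁿ and then Xᵐ past `formG` produces the q-integers of the two q-derivatives. -/
theorem d_normalOrder (hq0 : q ≠ 0) (hq1 : q ≠ 1) (f : PolyXg K) :
    Γ.d (PolyXg.normalOrder q f) =
      op (PolyXg.normalOrder q (PolyXg.qDerivG q f)) • Γ.d (g q) +
        op (PolyXg.normalOrder q (PolyXg.qDerivX q f)) • Γ.d (X q) := by
  suffices Γ.d ∘ₗ PolyXg.normalOrder q =
      rightOrbit (Γ.d (g q)) ∘ₗ PolyXg.normalOrder q ∘ₗ PolyXg.qDerivG q +
        rightOrbit (Γ.d (X q)) ∘ₗ PolyXg.normalOrder q ∘ₗ PolyXg.qDerivX q from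
    LinearMap.congr_fun this f
  refine PolyXg.linearMap_ext fun n m => ?_
  have hq1' : q - 1 ≠ 0 := sub_ne_zero.mpr hq1
  have hq1'' : 1 - q ≠ 0 := sub_ne_zero.mpr hq1.symm
  refine smul_right_injective _ hq1' ?_
  change (q - 1) • Γ.d (PolyXg.normalOrder q (PolyXg.monomial n m 1)) =
    (q - 1) • (op (PolyXg.normalOrder q (PolyXg.qDerivG q (PolyXg.monomial n m 1))) • Γ.d (g q) +
      op (PolyXg.normalOrder q (PolyXg.qDerivX q (PolyXg.monomial n m 1))) • Γ.d (X q))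
  rw [h.smul_d_eq]
  simp only [PolyXg.normalOrder, PolyXg.qDerivG, PolyXg.qDerivX, PolyXg.extend_monomial, one_smul,
    op_smul, smul_assoc, d_g, d_X, smul_add]
  have e1 : op ((gUnit q ^ (n - 1) : (CqB q)ˣ) * X q ^ m) • op (g q) • formG Γ =
      op ((gUnit q ^ n : (CqB q)ˣ) * X q ^ m) • formG Γ := by
    rw [smul_smul, ← op_mul, ← mul_assoc]
    congr 3
    change ((gUnit q : (CqB q)ˣ) : CqB q) * _ = _
    rw [← Units.val_mul, ← zpow_one_add, add_sub_cancel]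
  rw [e1]
  have hgu := gUnit_zpow_smul hq0 h.g_smul_formG n
  have hgv := gUnit_zpow_smul (x := formX Γ) (c := (1 : K)) one_ne_zero
    (by rw [h.g_smul_formX, one_smul]) n
  rw [one_zpow, one_smul] at hgv
  -- For `m = 0` the truncated exponent `m - 1` is harmless, since its coefficient contains `1 - q ^
  -- 0 = 0`.
  cases m with
  | zero =>
    simp only [pow_zero, mul_one, hgu, sub_self, zero_div, zero_smul, smul_zero, add_zero]
    rw [smul_smul, ← neg_sub q 1, ← neg_sub (q ^ n) 1, neg_div_neg_eq, mul_div_cancel₀ _ hq1']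
    generalize op (_ : CqB q) • formG Γ = y
    module
  | succ m =>
    have e2 : op ((gUnit q ^ n : (CqB q)ˣ) * X q ^ m) • op (X q) • formG Γ =
        q ^ n • op ((gUnit q ^ n : (CqB q)ˣ) * X q ^ (m + 1)) • formG Γ := by
      rw [smul_smul, ← op_mul, ← mul_assoc, X_mul_gUnit_zpow hq0, smul_mul_assoc, mul_assoc,
        ← pow_succ', op_smul, smul_assoc]
    have e3 : ((gUnit q ^ n : (CqB q)ˣ) * X q ^ (m + 1)) • formG Γ =
        (q ^ n * q ^ (m + 1)) • op ((gUnit q ^ n : (CqB q)ˣ) * X q ^ (m + 1)) • formG Γ +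
          (q ^ (m + 1) - 1) • op ((gUnit q ^ n : (CqB q)ˣ) * X q ^ m) • formX Γ := by
      rw [mul_smul, h.X_pow_smul_formG, smul_add, smul_comm _ (q ^ (m + 1)), smul_comm _ (_ - _),
        smul_comm _ (op (X q ^ (m + 1))),
        smul_comm _ (op (X q ^ m)), hgu, hgv, smul_comm (op (X q ^ (m + 1))) (q ^ n), op_mul, op_mul,
        mul_smul, mul_smul, mul_smul, smul_comm (q ^ n) (q ^ (m + 1))]
    rw [Nat.add_sub_cancel, e2, e3]
    generalize op (_ : CqB q) • formG Γ = y
    generalize op (_ : CqB q) • formX Γ = z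
    match_scalars
    · field_simp
      ring
    · field_simp
      ring

theorem qComm_g_d_X : Γ.qComm 1 (g q) (Γ.d (X q)) = 0 := by
  rw [FirstOrderCalculus.qComm, d_X, smul_add, smul_add, smul_comm (g q) (op (X q)), h.g_smul_formG,
    h.g_smul_formX, op_g_op_X, smul_comm (op (X q)) q]
  generalize op (X q) • op (g q) • formG Γ = y
  generalize op (g q) • formX Γ = z
  module

theorem qComm_g_d_g : Γ.qComm q (g q) (Γ.d (g q)) = 0 := by
  rw [FirstOrderCalculus.qComm, d_g, smul_comm (g q) (op (g q)), h.g_smul_formG,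
    smul_comm (op (g q)) q]
  generalize op (g q) • op (g q) • formG Γ = y
  module

theorem qComm_X_d_X : Γ.qComm q (X q) (Γ.d (X q)) = 0 := by
  rw [FirstOrderCalculus.qComm, d_X, smul_add, smul_add, smul_comm (X q) (op (X q)), h.X_smul_formG,
    h.X_smul_formX, smul_add, smul_comm (op (X q)) q, smul_comm (op (X q)) (q - 1)]
  generalize op (X q) • op (X q) • formG Γ = y
  generalize op (X q) • formX Γ = z
  module

theorem qComm_X_d_g :
    Γ.qComm q (X q) (Γ.d (g q)) = (q - 1) • (op (g q) • Γ.d (X q)) := by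
  rw [FirstOrderCalculus.qComm, d_X, d_g, smul_add, smul_comm (X q) (op (g q)), h.X_smul_formG,
    smul_add, smul_comm (op (g q)) q, smul_comm (op (g q)) (q - 1), op_g_op_X]
  generalize op (X q) • op (g q) • formG Γ = y
  generalize op (g q) • formX Γ = z
  module

theorem exists_eq_op_smul_add (hq0 : q ≠ 0) (x : Γ.carrier) :
    ∃ a b : CqB q, x = op a • formG Γ + op b • formX Γ :=
  CqB.exists_eq_op_smul_add hq0 one_ne_zero h.g_smul_formG
    (by rw [h.g_smul_formX, one_smul]) h.X_smul_formG (by rw [h.X_smul_formX, one_smul]) x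

end IsStandard

variable (Γ) in
/-- The map `(a, b) ↦ u a + v b`, where `u` and `v` are the forms `formG` and `formX`. -/
noncomputable def formsMap : CqB q × CqB q →ₗ[K] Γ.carrier :=
  (rightOrbit (formG Γ)).coprod (rightOrbit (formX Γ))

theorem formsMap_apply (a b : CqB q) :
    formsMap Γ (a, b) = op a • formG Γ + op b • formX Γ := by
  simp [formsMap]

end Standard

/-! ### Construction of the calculus on a free right module -/

section Model

variable (q)

/-- The free right module of rank two over `C_q(B_+)`: the pair `(a, b)` stands for `u a + v b`. -/
def Model : Type u := CqB q × CqB q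

namespace Model

noncomputable instance : AddCommGroup (Model q) := inferInstanceAs (AddCommGroup (CqB q × CqB q))

noncomputable instance : Module K (Model q) := inferInstanceAs (Module K (CqB q × CqB q))

noncomputable instance : Module (CqB q)ᵐᵒᵖ (Model q) :=
  inferInstanceAs (Module (CqB q)ᵐᵒᵖ (CqB q × CqB q))

instance : IsScalarTower K (CqB q)ᵐᵒᵖ (Model q) :=
  inferInstanceAs (IsScalarTower K (CqB q)ᵐᵒᵖ (CqB q × CqB q))

instance : SMulCommClass (CqB q)ᵐᵒᵖ K (Model q) :=
  inferInstanceAs (SMulCommClass (CqB q)ᵐᵒᵖ K (CqB q × CqB q))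

/-- The inclusion `a ↦ u a`. -/
noncomputable def inl : CqB q →ₗ[K] Model q := LinearMap.inl K (CqB q) (CqB q)

/-- The inclusion `b ↦ v b`. -/
noncomputable def inr : CqB q →ₗ[K] Model q := LinearMap.inr K (CqB q) (CqB q)

/-- The coefficient of `u`. -/
noncomputable def fst : Model q →ₗ[K] CqB q := LinearMap.fst K (CqB q) (CqB q)

/-- The coefficient of `v`. -/
noncomputable def snd : Model q →ₗ[K] CqB q := LinearMap.snd K (CqB q) (CqB q)

variable {q}

theorem eq_inl_add_inr (x : Model q) : x = inl q (fst q x) + inr q (snd q x) :=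
  (Prod.fst_add_snd x).symm

theorem op_smul_inl (a b : CqB q) : op a • inl q b = inl q (b * a) :=
  Prod.ext rfl (zero_mul a)

theorem op_smul_inr (a b : CqB q) : op a • inr q b = inr q (b * a) :=
  Prod.ext (zero_mul a) rfl

theorem op_smul_smul (a : CqB q) (c : K) (x : Model q) : op a • c • x = c • op a • x :=
  smul_comm _ _ _

/-- The right linear map with given values at `u` and `v`. -/
noncomputable def lift {M : Type*} [AddCommGroup M] [Module (CqB q)ᵐᵒᵖ M] (x y : M) :
    Model q →ₗ[(CqB q)ᵐᵒᵖ] M where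
  toFun z := op (fst q z) • x + op (snd q z) • y
  map_add' z z' := by
    simp only [map_add, op_add, add_smul]
    abel
  map_smul' c z := by
    change op (fst q z * c.unop) • x + op (snd q z * c.unop) • y = _
    simp only [op_mul, mul_smul, op_unop, smul_add, RingHom.id_apply]

section

variable {M : Type*} [AddCommGroup M] [Module (CqB q)ᵐᵒᵖ M] (x y : M) (a : CqB q)

@[simp] theorem lift_inl : lift x y (inl q a) = op a • x := by
  change op a • x + op (0 : CqB q) • y = _
  simp

@[simp] theorem lift_inr : lift x y (inr q a) = op a • y := by
  change op (0 : CqB q) • x + op a • y = _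
  simp

theorem lift_ext {f f' : Model q →ₗ[(CqB q)ᵐᵒᵖ] M} (h1 : f (inl q 1) = f' (inl q 1))
    (h2 : f (inr q 1) = f' (inr q 1)) : f = f' := by
  ext z
  have hz : z = op (fst q z) • inl q 1 + op (snd q z) • inr q 1 := by
    rw [op_smul_inl, op_smul_inr, one_mul, one_mul]
    exact eq_inl_add_inr z
  rw [hz, map_add, map_add, map_smul, map_smul, map_smul, map_smul, h1, h2]

end

/-- The left action of `C_q(B_+)`: `g u = q u g`, `g v = v g`, `X u = q u X + (q - 1) v`,
`X v = v X`. -/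
noncomputable def action (hq0 : q ≠ 0) : CqB q →ₐ[K] Module.End (CqB q)ᵐᵒᵖ (Model q) :=
  -- A left action commuting with the right one is a homomorphism to right linear endomorphisms, so
  -- each defining relation need only be checked at u and v.
  CqB.lift (lift (q • inl q (X q) + (q - 1) • inr q 1) (inr q (X q)))
    (lift (q • inl q (g q)) (inr q (g q))) (lift (q⁻¹ • inl q (gInv q)) (inr q (gInv q)))
    (by
      refine lift_ext ?_ ?_ <;>
        simp [op_smul_inl, op_smul_inr, op_smul_smul, hq0, g_mul_gInv])
    (by
      refine lift_ext ?_ ?_ <;>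
        simp [op_smul_inl, op_smul_inr, op_smul_smul, hq0, gInv_mul_g])
    (by
      refine lift_ext ?_ ?_ <;>
        simp [op_smul_inl, op_smul_inr, op_smul_smul, X_mul_g])

end Model

end Model

namespace Model

variable (hq0 : q ≠ 0)

theorem action_X_inl (a : CqB q) :
    action hq0 (X q) (inl q a) = q • inl q (X q * a) + (q - 1) • inr q a := by
  simp [action, op_smul_inl, op_smul_inr, op_smul_smul]

theorem action_X_inr (a : CqB q) : action hq0 (X q) (inr q a) = inr q (X q * a) := by
  simp [action, op_smul_inr]

theorem action_g_inl (a : CqB q) : action hq0 (g q) (inl q a) = q • inl q (g q * a) := by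
  simp [action, op_smul_inl, op_smul_smul]

theorem action_g_inr (a : CqB q) : action hq0 (g q) (inr q a) = inr q (g q * a) := by
  simp [action, op_smul_inr]

/-- The inner derivation `a ↦ (q - 1)⁻¹ [a, u]`. -/
noncomputable def diff : CqB q →ₗ[K] Model q where
  toFun a := (q - 1)⁻¹ • (action hq0 a (inl q 1) - inl q a)
  map_add' a b := by
    simp only [map_add, LinearMap.add_apply, ← smul_add]
    congr 1
    abel
  map_smul' c a := by
    simp only [map_smul, LinearMap.smul_apply, ← smul_sub, RingHom.id_apply, smul_comm _ c]

theorem diff_apply (a : CqB q) :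
    diff hq0 a = (q - 1)⁻¹ • (action hq0 a (inl q 1) - inl q a) := rfl

theorem diff_mul (a b : CqB q) :
    diff hq0 (a * b) = action hq0 a (diff hq0 b) + op b • diff hq0 a := by
  have h := (action hq0 a).map_smul (op b) (inl q 1)
  rw [op_smul_inl, one_mul] at h
  rw [diff_apply, diff_apply, diff_apply, op_smul_smul, LinearMap.map_smul_of_tower, ← smul_add,
    map_mul, Module.End.mul_apply, map_sub, h, smul_sub (op b), op_smul_inl]
  congr 1
  abel

theorem diff_g (hq1 : q ≠ 1) : diff hq0 (g q) = inl q (g q) := by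
  have hq1' : q - 1 ≠ 0 := sub_ne_zero.mpr hq1
  rw [diff_apply, action_g_inl, mul_one, inv_smul_eq_iff₀ hq1']
  module

theorem diff_X (hq1 : q ≠ 1) : diff hq0 (X q) = inl q (X q) + inr q 1 := by
  have hq1' : q - 1 ≠ 0 := sub_ne_zero.mpr hq1
  rw [diff_apply, action_X_inl, mul_one, inv_smul_eq_iff₀ hq1']
  module

/-- The two-dimensional first order calculus. -/
noncomputable def calculus (hq1 : q ≠ 1) : FirstOrderCalculus.{u, u, u} K (CqB q) :=
  letI : Module (CqB q) (Model q) := Module.compHom _ (action hq0).toRingHom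
  { carrier := Model q
    instTowerLeft := ⟨fun c a x => by
      change action hq0 (c • a) x = c • action hq0 a x
      rw [map_smul, LinearMap.smul_apply]⟩
    instBimodule := ⟨fun a b x => (action hq0 a).map_smul b x⟩
    d := diff hq0
    leibniz := diff_mul hq0
    span_d := by
      set S := Submodule.span (CqB q) (Set.range (diff hq0)) with hS
      -- The left span of the differentials is a sub-bimodule because (da) b = d(ab) - a db; it then
      -- suffices that it contains dg = u g and dX = u X + v.
      have hop : ∀ (b : CqB q) (x : Model q), x ∈ S → op b • x ∈ S := by
        intro b x hx
        rw [hS] at hx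
        induction hx using Submodule.span_induction with
        | mem x hx =>
          obtain ⟨a, rfl⟩ := hx
          rw [← sub_eq_iff_eq_add'.mpr (diff_mul hq0 a b)]
          exact S.sub_mem (Submodule.subset_span ⟨_, rfl⟩)
            (S.smul_mem a (Submodule.subset_span ⟨_, rfl⟩))
        | zero => simp
        | add x y _ _ hx hy => rw [smul_add]; exact S.add_mem hx hy
        | smul a x _ hx =>
          have : op b • a • x = a • op b • x := ((action hq0 a).map_smul (op b) x).symm
          rw [this]
          exact S.smul_mem a hx
      have hl : ∀ a, inl q a ∈ S := by
        intro a
        have h : inl q (g q) ∈ S := diff_g hq0 hq1 ▸ Submodule.subset_span ⟨_, rfl⟩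
        have := hop (gInv q * a) _ h
        rwa [op_smul_inl, ← mul_assoc, g_mul_gInv, one_mul] at this
      have hr : ∀ a, inr q a ∈ S := by
        intro a
        have h : inl q (X q) + inr q 1 ∈ S := diff_X hq0 hq1 ▸ Submodule.subset_span ⟨_, rfl⟩
        have := hop a _ ((S.add_mem_iff_right (hl _)).mp h)
        rwa [op_smul_inr, one_mul] at this
      refine eq_top_iff.mpr fun x _ => ?_
      rw [eq_inl_add_inr x]
      exact S.add_mem (hl _) (hr _) }

theorem formG_calculus (hq1 : q ≠ 1) : formG (calculus hq0 hq1) = inl q 1 := by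
  change op (gInv q) • diff hq0 (g q) = inl q 1
  rw [diff_g hq0 hq1, op_smul_inl, g_mul_gInv]

theorem formX_calculus (hq1 : q ≠ 1) : formX (calculus hq0 hq1) = inr q 1 := by
  rw [formX, formG_calculus hq0 hq1]
  change diff hq0 (X q) - op (X q) • inl q 1 = inr q 1
  rw [diff_X hq0 hq1, op_smul_inl, one_mul, add_sub_cancel_left]

theorem isStandard_calculus (hq1 : q ≠ 1) : IsStandard (calculus hq0 hq1) where
  g_smul_formG := by
    rw [formG_calculus hq0 hq1]
    change action hq0 (g q) (inl q 1) = q • op (g q) • inl q 1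
    rw [action_g_inl, op_smul_inl, mul_one, one_mul]
  g_smul_formX := by
    rw [formX_calculus hq0 hq1]
    change action hq0 (g q) (inr q 1) = op (g q) • inr q 1
    rw [action_g_inr, op_smul_inr, mul_one, one_mul]
  X_smul_formG := by
    rw [formG_calculus hq0 hq1, formX_calculus hq0 hq1]
    change action hq0 (X q) (inl q 1) = q • op (X q) • inl q 1 + (q - 1) • inr q 1
    rw [action_X_inl, op_smul_inl, mul_one, one_mul]
  X_smul_formX := by
    rw [formX_calculus hq0 hq1]
    change action hq0 (X q) (inr q 1) = op (X q) • inr q 1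
    rw [action_X_inr, op_smul_inr, mul_one, one_mul]

theorem formsMap_calculus_injective (hq1 : q ≠ 1) :
    Function.Injective (formsMap (calculus hq0 hq1)) := by
  have h : ∀ p, formsMap (calculus hq0 hq1) p = p := by
    rintro ⟨a, b⟩
    rw [formsMap_apply, formG_calculus hq0 hq1, formX_calculus hq0 hq1]
    change op a • inl q 1 + op b • inr q 1 = ((a, b) : Model q)
    rw [op_smul_inl, op_smul_inr, one_mul, one_mul]
    exact (eq_inl_add_inr ((a, b) : Model q)).symm
  intro p p' hp
  rwa [h, h] at hp

end Model

/-! ### Calculi with free generators: uniqueness and coactions -/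

section Free

variable {Γ : FirstOrderCalculus.{u, u, w} K (CqB q)} (h : IsStandard Γ) (hq0 : q ≠ 0)
  (hq1 : q ≠ 1) (hinj : Function.Injective (formsMap Γ))

theorem IsStandard.formsMap_surjective {Γ : FirstOrderCalculus.{u, u, w} K (CqB q)}
    (h : IsStandard Γ) (hq0 : q ≠ 0) : Function.Surjective (formsMap Γ) := by
  intro x
  obtain ⟨a, b, rfl⟩ := h.exists_eq_op_smul_add hq0 x
  exact ⟨(a, b), formsMap_apply a b⟩

/-- The coordinates of a one-form with respect to `formG` and `formX`. -/
noncomputable def formsEquiv : (CqB q × CqB q) ≃ₗ[K] Γ.carrier :=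
  LinearEquiv.ofBijective (formsMap Γ) ⟨hinj, h.formsMap_surjective hq0⟩

theorem formsEquiv_symm_formG (a : CqB q) :
    (formsEquiv h hq0 hinj).symm (op a • formG Γ) = (a, 0) := by
  rw [LinearEquiv.symm_apply_eq]
  change _ = formsMap Γ (a, 0)
  simp [formsMap_apply]

theorem formsEquiv_symm_formX (b : CqB q) :
    (formsEquiv h hq0 hinj).symm (op b • formX Γ) = (0, b) := by
  rw [LinearEquiv.symm_apply_eq]
  change _ = formsMap Γ (0, b)
  simp [formsMap_apply]

section Hom

variable {Γ' : FirstOrderCalculus.{u, u, w'} K (CqB q)} (h' : IsStandard Γ')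

/-- The bimodule map that sends `formG`, `formX` to `formG`, `formX`, as a linear map. -/
noncomputable def formsHom (Γ' : FirstOrderCalculus.{u, u, w'} K (CqB q)) :
    Γ.carrier →ₗ[K] Γ'.carrier :=
  formsMap Γ' ∘ₗ (formsEquiv h hq0 hinj).symm.toLinearMap

theorem formsHom_op_smul_formG (a : CqB q) :
    formsHom h hq0 hinj Γ' (op a • formG Γ) = op a • formG Γ' := by
  simp [formsHom, formsEquiv_symm_formG, formsMap_apply]

theorem formsHom_op_smul_formX (a : CqB q) :
    formsHom h hq0 hinj Γ' (op a • formX Γ) = op a • formX Γ' := by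
  simp [formsHom, formsEquiv_symm_formX, formsMap_apply]

theorem formsHom_op_smul (a : CqB q) (x : Γ.carrier) :
    formsHom h hq0 hinj Γ' (op a • x) = op a • formsHom h hq0 hinj Γ' x := by
  obtain ⟨b, c, rfl⟩ := h.exists_eq_op_smul_add hq0 x
  simp only [smul_add, map_add, smul_smul, ← op_mul, formsHom_op_smul_formG,
    formsHom_op_smul_formX]

include h' in
-- The map is right linear by construction. It commutes with left multiplication because both
-- calculi satisfy the same relations on the two forms.
theorem formsHom_smul (a : CqB q) (x : Γ.carrier) :
    formsHom h hq0 hinj Γ' (a • x) = a • formsHom h hq0 hinj Γ' x := by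
  have hu := formsHom_op_smul_formG h hq0 hinj (Γ' := Γ') 1
  have hv := formsHom_op_smul_formX h hq0 hinj (Γ' := Γ') 1
  simp only [op_one, one_smul] at hu hv
  have key : ∀ a : CqB q,
      formsHom h hq0 hinj Γ' (a • formG Γ) = a • formG Γ' →
      formsHom h hq0 hinj Γ' (a • formX Γ) = a • formX Γ' →
      ∀ x, formsHom h hq0 hinj Γ' (a • x) = a • formsHom h hq0 hinj Γ' x := by
    intro a h1 h2 x
    obtain ⟨b, c, rfl⟩ := h.exists_eq_op_smul_add hq0 x
    rw [smul_add, smul_comm a, smul_comm a, map_add, map_add, smul_add, formsHom_op_smul,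
      formsHom_op_smul, formsHom_op_smul, formsHom_op_smul, h1, h2, hu, hv, smul_comm a,
      smul_comm a]
  induction a using CqB.induction generalizing x with
  | hs c => rw [algebraMap_smul, algebraMap_smul, map_smul]
  | hX =>
    refine key _ ?_ ?_ x
    · rw [h.X_smul_formG, h'.X_smul_formG, map_add, map_smul _ q, map_smul _ (q - 1),
        formsHom_op_smul, hu, hv]
    · rw [h.X_smul_formX, h'.X_smul_formX, formsHom_op_smul, hv]
  | hg =>
    refine key _ ?_ ?_ x
    · rw [h.g_smul_formG, h'.g_smul_formG, map_smul, formsHom_op_smul, hu]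
    · rw [h.g_smul_formX, h'.g_smul_formX, formsHom_op_smul, hv]
  | hi =>
    refine key _ ?_ ?_ x
    · rw [gInv_smul_of_g_smul hq0 h.g_smul_formG, gInv_smul_of_g_smul hq0 h'.g_smul_formG,
        map_smul, formsHom_op_smul, hu]
    · rw [gInv_smul_of_g_smul one_ne_zero (by rw [h.g_smul_formX, one_smul]),
        gInv_smul_of_g_smul one_ne_zero (by rw [h'.g_smul_formX, one_smul]),
        map_smul, formsHom_op_smul, hv]
  | hm a b ha hb => rw [mul_smul, ha, hb, mul_smul]
  | ha a b ha hb => rw [add_smul, map_add, ha, hb, add_smul]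

include hq1 h' in
-- Both differentials are the commutator with `formG` divided by q - 1, and the bimodule map carries
-- `formG` to `formG`.
theorem formsHom_d (a : CqB q) : formsHom h hq0 hinj Γ' (Γ.d a) = Γ'.d a := by
  have hu := formsHom_op_smul_formG h hq0 hinj (Γ' := Γ') 1
  simp only [op_one, one_smul] at hu
  refine smul_right_injective _ (sub_ne_zero.mpr hq1) ?_
  change (q - 1) • _ = (q - 1) • _
  rw [← map_smul, h.smul_d_eq, h'.smul_d_eq, map_sub, formsHom_smul h hq0 hinj h',
    formsHom_op_smul, hu]

include hq0 hq1 hinj h h' in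
theorem isIsomorphic_of_injective (hinj' : Function.Injective (formsMap Γ')) :
    FirstOrderCalculus.IsIsomorphic Γ Γ' :=
  ⟨{ toLinearMap :=
      { toFun := formsHom h hq0 hinj Γ'
        map_add' := map_add _
        map_smul' := formsHom_smul h hq0 hinj h' }
     map_op_smul := formsHom_op_smul h hq0 hinj
     map_d := formsHom_d h hq0 hq1 hinj h' },
    (show Function.Bijective (formsMap Γ' ∘ (formsEquiv h hq0 hinj).symm) from
      Function.Bijective.comp ⟨hinj', h'.formsMap_surjective hq0⟩
        (formsEquiv h hq0 hinj).symm.bijective)⟩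

end Hom

section Coaction

/-- The right coaction `u ↦ u ⊗ 1`, `v ↦ v ⊗ 1`. -/
noncomputable def coactR : Γ.carrier →ₗ[K] Γ.carrier ⊗[K] CqB q :=
  (((rightOrbit (formG Γ)).rTensor _ ∘ₗ Coalgebra.comul).coprod
    ((rightOrbit (formX Γ)).rTensor _ ∘ₗ Coalgebra.comul)) ∘ₗ
      (formsEquiv h hq0 hinj).symm.toLinearMap

/-- The left coaction `u ↦ 1 ⊗ u`, `v ↦ g ⊗ v - X ⊗ u`. -/
noncomputable def coactL : Γ.carrier →ₗ[K] CqB q ⊗[K] Γ.carrier :=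
  (((rightOrbit (formG Γ)).lTensor _ ∘ₗ Coalgebra.comul).coprod
    (((rightOrbit (formX Γ)).lTensor _ ∘ₗ LinearMap.mulLeft K (g q ⊗ₜ 1) -
      (rightOrbit (formG Γ)).lTensor _ ∘ₗ LinearMap.mulLeft K (X q ⊗ₜ 1)) ∘ₗ Coalgebra.comul)) ∘ₗ
        (formsEquiv h hq0 hinj).symm.toLinearMap

theorem coactR_formG (a : CqB q) : coactR h hq0 hinj (op a • formG Γ) =
    (rightOrbit (formG Γ)).rTensor _ (Coalgebra.comul (R := K) a) := by
  simp [coactR, formsEquiv_symm_formG]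

theorem coactR_formX (a : CqB q) : coactR h hq0 hinj (op a • formX Γ) =
    (rightOrbit (formX Γ)).rTensor _ (Coalgebra.comul (R := K) a) := by
  simp [coactR, formsEquiv_symm_formX]

theorem coactL_formG (a : CqB q) : coactL h hq0 hinj (op a • formG Γ) =
    (rightOrbit (formG Γ)).lTensor _ (Coalgebra.comul (R := K) a) := by
  simp [coactL, formsEquiv_symm_formG]

/-- The value at v is forced by v = dX - u X: g ⊗ dX - (1 ⊗ u)(X ⊗ 1 + g ⊗ X) = g ⊗ v - X ⊗ u. -/
theorem coactL_formX (a : CqB q) : coactL h hq0 hinj (op a • formX Γ) =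
    (rightOrbit (formX Γ)).lTensor _ (g q ⊗ₜ 1 * Coalgebra.comul (R := K) a) -
      (rightOrbit (formG Γ)).lTensor _ (X q ⊗ₜ 1 * Coalgebra.comul (R := K) a) := by
  simp [coactL, formsEquiv_symm_formX]

theorem smulRight_algebraMap (c : K) (z : Γ.carrier ⊗[K] CqB q) :
    Γ.smulRight (algebraMap K _ c) z = c • z := by
  induction z with
  | zero => simp
  | add y z hy hz => rw [map_add, hy, hz, smul_add]
  | tmul x a =>
    rw [Algebra.TensorProduct.algebraMap_apply, FirstOrderCalculus.smulRight_tmul, one_mul,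
      algebraMap_smul, TensorProduct.smul_tmul']

theorem smulLeft_algebraMap (c : K) (z : CqB q ⊗[K] Γ.carrier) :
    Γ.smulLeft (algebraMap K _ c) z = c • z := by
  induction z with
  | zero => simp
  | add y z hy hz => rw [map_add, hy, hz, smul_add]
  | tmul a x =>
    rw [Algebra.TensorProduct.algebraMap_apply, FirstOrderCalculus.smulLeft_tmul, one_smul,
      ← Algebra.smul_def, TensorProduct.smul_tmul']

/-- A linear map that intertwines the left actions of `g` and `X` on the generators does so for
the actions of all elements. -/
theorem intertwines_of_generators {M : Type*} [AddCommGroup M] [Module K M]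
    (f : Γ.carrier →ₗ[K] M) (act : CqB q →ₐ[K] Module.End K M)
    (hX : ∀ x, f (X q • x) = act (X q) (f x)) (hg : ∀ x, f (g q • x) = act (g q) (f x))
    (a : CqB q) (x : Γ.carrier) : f (a • x) = act a (f x) := by
  induction a using CqB.induction generalizing x with
  | hs c => rw [algebraMap_smul, AlgHom.commutes, map_smul, Module.algebraMap_end_apply]
  | hX => exact hX x
  | hg => exact hg x
  | hi =>
    -- Compatibility with g⁻¹ follows by inverting that with g.
    have h1 := congrArg (act (gInv q)) (hg (gInv q • x))
    rw [g_smul_gInv_smul, ← Module.End.mul_apply, ← map_mul, gInv_mul_g, map_one] at h1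
    exact h1.symm
  | hm a b ha hb => rw [mul_smul, ha, hb, map_mul, Module.End.mul_apply]
  | ha a b ha hb => rw [add_smul, map_add, ha, hb, map_add, LinearMap.add_apply]

variable (Γ) in
/-- The left action of `A` on `Γ ⊗ A` through the coproduct. -/
noncomputable def diagRight : CqB q →ₐ[K] Module.End K (Γ.carrier ⊗[K] CqB q) :=
  (AlgHom.ofLinearMap Γ.smulRight
    (LinearMap.ext fun z => by
      rw [← map_one (algebraMap K (CqB q ⊗[K] CqB q)), smulRight_algebraMap, one_smul]
      rfl)
    fun s t => LinearMap.ext (Γ.smulRight_mul s t)).comp (Bialgebra.comulAlgHom K (CqB q))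

variable (Γ) in
/-- The left action of `A` on `A ⊗ Γ` through the coproduct. -/
noncomputable def diagLeft : CqB q →ₐ[K] Module.End K (CqB q ⊗[K] Γ.carrier) :=
  (AlgHom.ofLinearMap Γ.smulLeft
    (LinearMap.ext fun z => by
      rw [← map_one (algebraMap K (CqB q ⊗[K] CqB q)), smulLeft_algebraMap, one_smul]
      rfl)
    fun s t => LinearMap.ext (Γ.smulLeft_mul s t)).comp (Bialgebra.comulAlgHom K (CqB q))

include h

theorem IsStandard.X_smul_op_smul_formG (a : CqB q) : X q • op a • formG Γ =
    q • op (X q * a) • formG Γ + (q - 1) • op a • formX Γ := by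
  rw [smul_comm, h.X_smul_formG, smul_add, smul_comm _ q, smul_comm _ (q - 1), smul_smul (op a),
    ← op_mul]

theorem IsStandard.X_smul_op_smul_formX (a : CqB q) :
    X q • op a • formX Γ = op (X q * a) • formX Γ := by
  rw [smul_comm, h.X_smul_formX, smul_smul, ← op_mul]

theorem IsStandard.g_smul_op_smul_formG (a : CqB q) :
    g q • op a • formG Γ = q • op (g q * a) • formG Γ := by
  rw [smul_comm, h.g_smul_formG, smul_comm _ q, smul_smul (op a), ← op_mul]

theorem IsStandard.g_smul_op_smul_formX (a : CqB q) :
    g q • op a • formX Γ = op (g q * a) • formX Γ := by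
  rw [smul_comm, h.g_smul_formX, smul_smul, ← op_mul]

omit h in
theorem X_mul_g_mul (a : CqB q) : X q * (g q * a) = q • (g q * (X q * a)) := by
  rw [← mul_assoc, X_mul_g, smul_mul_assoc, mul_assoc]

theorem coactR_X_smul (x : Γ.carrier) : coactR h hq0 hinj (X q • x) =
    Γ.smulRight (Coalgebra.comul (R := K) (X q)) (coactR h hq0 hinj x) := by
  obtain ⟨b, c, rfl⟩ := h.exists_eq_op_smul_add hq0 x
  rw [smul_add, h.X_smul_op_smul_formG, h.X_smul_op_smul_formX]
  simp only [map_add, map_smul, coactR_formG, coactR_formX, Bialgebra.comul_mul, comul_X]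
  generalize Coalgebra.comul (R := K) b = s
  generalize Coalgebra.comul (R := K) c = t
  congr 1
  · induction s with
    | zero => simp
    | add s s' hs hs' => simp only [mul_add, map_add, smul_add, ← hs, ← hs']; abel
    | tmul b c =>
      simp only [add_mul, Algebra.TensorProduct.tmul_mul_tmul, map_add, LinearMap.rTensor_tmul,
        rightOrbit_apply, LinearMap.add_apply, FirstOrderCalculus.smulRight_tmul, one_mul,
        h.X_smul_op_smul_formG, h.g_smul_op_smul_formG, TensorProduct.add_tmul,
        ← TensorProduct.smul_tmul' q, ← TensorProduct.smul_tmul' (q - 1)]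
      module
  · induction t with
    | zero => simp
    | add s s' hs hs' => simp only [mul_add, map_add, ← hs, ← hs']
    | tmul b c =>
      simp only [add_mul, Algebra.TensorProduct.tmul_mul_tmul, map_add, LinearMap.rTensor_tmul,
        rightOrbit_apply, LinearMap.add_apply, FirstOrderCalculus.smulRight_tmul, one_mul,
        h.X_smul_op_smul_formX, h.g_smul_op_smul_formX]

theorem coactR_g_smul (x : Γ.carrier) : coactR h hq0 hinj (g q • x) =
    Γ.smulRight (Coalgebra.comul (R := K) (g q)) (coactR h hq0 hinj x) := by
  obtain ⟨b, c, rfl⟩ := h.exists_eq_op_smul_add hq0 x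
  rw [smul_add, h.g_smul_op_smul_formG, h.g_smul_op_smul_formX]
  simp only [map_add, map_smul, coactR_formG, coactR_formX, Bialgebra.comul_mul, comul_g]
  generalize Coalgebra.comul (R := K) b = s
  generalize Coalgebra.comul (R := K) c = t
  congr 1
  · induction s with
    | zero => simp
    | add s s' hs hs' => simp only [mul_add, map_add, smul_add, ← hs, ← hs']
    | tmul b c =>
      simp [h.g_smul_op_smul_formG, TensorProduct.smul_tmul']
  · induction t with
    | zero => simp
    | add s s' hs hs' => simp only [mul_add, map_add, ← hs, ← hs']
    | tmul b c => simp [h.g_smul_op_smul_formX]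

theorem coactL_X_smul (x : Γ.carrier) : coactL h hq0 hinj (X q • x) =
    Γ.smulLeft (Coalgebra.comul (R := K) (X q)) (coactL h hq0 hinj x) := by
  obtain ⟨b, c, rfl⟩ := h.exists_eq_op_smul_add hq0 x
  rw [smul_add, h.X_smul_op_smul_formG, h.X_smul_op_smul_formX]
  simp only [map_add, map_smul, coactL_formG, coactL_formX, Bialgebra.comul_mul, comul_X]
  generalize Coalgebra.comul (R := K) b = s
  generalize Coalgebra.comul (R := K) c = t
  congr 1
  · induction s with
    | zero => simp
    | add s s' hs hs' =>
      simp only [mul_add, map_add, ← hs, ← hs']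
      module
    | tmul b c =>
      simp only [add_mul, Algebra.TensorProduct.tmul_mul_tmul, map_add, LinearMap.lTensor_tmul,
        rightOrbit_apply, LinearMap.add_apply, FirstOrderCalculus.smulLeft_tmul, one_mul, one_smul,
        h.X_smul_op_smul_formG, TensorProduct.tmul_add, TensorProduct.tmul_smul]
      module
  · induction t with
    | zero => simp
    | add s s' hs hs' =>
      simp only [map_sub] at hs hs'
      simp only [mul_add, map_add, map_sub]
      linear_combination (norm := module) hs + hs'
    | tmul b c =>
      simp only [add_mul, mul_add, Algebra.TensorProduct.tmul_mul_tmul, map_add, map_sub,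
        LinearMap.lTensor_tmul, rightOrbit_apply, LinearMap.add_apply,
        FirstOrderCalculus.smulLeft_tmul, one_mul, one_smul, h.X_smul_op_smul_formG,
        h.X_smul_op_smul_formX, TensorProduct.tmul_add, TensorProduct.tmul_smul, X_mul_g_mul,
        ← TensorProduct.smul_tmul' q, map_smul]
      module

theorem coactL_g_smul (x : Γ.carrier) : coactL h hq0 hinj (g q • x) =
    Γ.smulLeft (Coalgebra.comul (R := K) (g q)) (coactL h hq0 hinj x) := by
  obtain ⟨b, c, rfl⟩ := h.exists_eq_op_smul_add hq0 x
  rw [smul_add, h.g_smul_op_smul_formG, h.g_smul_op_smul_formX]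
  simp only [map_add, map_smul, coactL_formG, coactL_formX, Bialgebra.comul_mul, comul_g]
  generalize Coalgebra.comul (R := K) b = s
  generalize Coalgebra.comul (R := K) c = t
  congr 1
  · induction s with
    | zero => simp
    | add s s' hs hs' => simp only [mul_add, map_add, smul_add, ← hs, ← hs']
    | tmul b c => simp [h.g_smul_op_smul_formG]
  · induction t with
    | zero => simp
    | add s s' hs hs' =>
      simp only [map_sub] at hs hs'
      simp only [mul_add, map_add, map_sub]
      linear_combination (norm := module) hs + hs'
    | tmul b c =>
      simp [h.g_smul_op_smul_formG, h.g_smul_op_smul_formX, X_mul_g_mul, TensorProduct.smul_tmul']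

theorem coactR_smul (a : CqB q) (x : Γ.carrier) : coactR h hq0 hinj (a • x) =
    Γ.smulRight (Coalgebra.comul (R := K) a) (coactR h hq0 hinj x) :=
  intertwines_of_generators (coactR h hq0 hinj) (diagRight Γ) (coactR_X_smul h hq0 hinj)
    (coactR_g_smul h hq0 hinj) a x

theorem coactL_smul (a : CqB q) (x : Γ.carrier) : coactL h hq0 hinj (a • x) =
    Γ.smulLeft (Coalgebra.comul (R := K) a) (coactL h hq0 hinj x) :=
  intertwines_of_generators (coactL h hq0 hinj) (diagLeft Γ) (coactL_X_smul h hq0 hinj)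
    (coactL_g_smul h hq0 hinj) a x

include hq1

/-- Since d is inner, this reduces to compatibility of the coaction with both multiplications on
`formG`, whose own coaction is trivial. -/
theorem coactR_d (a : CqB q) : coactR h hq0 hinj (Γ.d a) =
    Γ.d.rTensor _ (Coalgebra.comul (R := K) a) := by
  have hu := coactR_formG h hq0 hinj 1
  rw [op_one, one_smul, Bialgebra.comul_one, Algebra.TensorProduct.one_def, LinearMap.rTensor_tmul,
    rightOrbit_apply, op_one, one_smul] at hu
  refine smul_right_injective _ (sub_ne_zero.mpr hq1) ?_
  change (q - 1) • _ = (q - 1) • _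
  rw [← map_smul, h.smul_d_eq, map_sub, coactR_smul, hu, coactR_formG]
  induction Coalgebra.comul (R := K) a with
  | zero => simp
  | add s t hs ht =>
    simp only [map_add, smul_add, ← hs, ← ht, LinearMap.add_apply]
    abel
  | tmul b c =>
    simp [TensorProduct.smul_tmul', h.smul_d_eq, TensorProduct.sub_tmul]

theorem coactL_d (a : CqB q) : coactL h hq0 hinj (Γ.d a) =
    Γ.d.lTensor _ (Coalgebra.comul (R := K) a) := by
  have hu := coactL_formG h hq0 hinj 1
  rw [op_one, one_smul, Bialgebra.comul_one, Algebra.TensorProduct.one_def, LinearMap.lTensor_tmul,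
    rightOrbit_apply, op_one, one_smul] at hu
  refine smul_right_injective _ (sub_ne_zero.mpr hq1) ?_
  change (q - 1) • _ = (q - 1) • _
  rw [← map_smul, h.smul_d_eq, map_sub, coactL_smul, hu, coactL_formG]
  induction Coalgebra.comul (R := K) a with
  | zero => simp
  | add s t hs ht =>
    simp only [map_add, smul_add, ← hs, ← ht, LinearMap.add_apply]
    abel
  | tmul b c =>
    simp only [FirstOrderCalculus.smulLeft_tmul, LinearMap.lTensor_tmul, rightOrbit_apply, mul_one,
      ← TensorProduct.tmul_sub, ← TensorProduct.tmul_smul, h.smul_d_eq]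

omit hq1
variable (hq1 : q ≠ 1)

/-- A first order calculus with the standard relations in which `formG` and `formX` are free is
bicovariant. -/
noncomputable def bicovariantCalculus : BicovariantCalculus.{u, u, w} K (CqB q) where
  toFirstOrderCalculus := Γ
  coactL := coactL h hq0 hinj
  coactR := coactR h hq0 hinj
  coactL_smul_d a b := by rw [coactL_smul, coactL_d h hq0 hq1 hinj]
  coactR_smul_d a b := by rw [coactR_smul, coactR_d h hq0 hq1 hinj]

end Coaction

end Free

/-- In a bicovariant calculus with the standard relations in which `formG` and `formX` are
independent, these are a basis of the right invariant forms. -/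
theorem dim_eq_two (hq0 : q ≠ 0) {Γ : BicovariantCalculus.{u, u, w} K (CqB q)}
    (h : IsStandard Γ.toFirstOrderCalculus)
    (hli : LinearIndependent K ![formG Γ.toFirstOrderCalculus, formX Γ.toFirstOrderCalculus]) :
    Γ.dim = 2 := by
  have hspan : Γ.rightInvariants = Submodule.span K
      (Set.range ![formG Γ.toFirstOrderCalculus, formX Γ.toFirstOrderCalculus]) := by
    refine le_antisymm (fun x hx => ?_) ?_
    · obtain ⟨a, b, rfl⟩ := exists_eq_smul_add hx (h.exists_eq_op_smul_add hq0 x)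
      exact Submodule.add_mem _ (Submodule.smul_mem _ a (Submodule.subset_span ⟨0, rfl⟩))
        (Submodule.smul_mem _ b (Submodule.subset_span ⟨1, rfl⟩))
    · rw [Submodule.span_le, Set.range_subset_iff, Fin.forall_fin_two]
      exact ⟨formG_mem Γ, formX_mem Γ⟩
  rw [BicovariantCalculus.dim, hspan, rank_eq_card_basis (Module.Basis.span hli)]
  simp

/-- An instance of the Hopf module argument: the two forms are right invariant, so independence over
K becomes freeness over A. -/
theorem formsMap_injective {Γ : BicovariantCalculus.{u, u, w} K (CqB q)}
    (hli : LinearIndependent K ![formG Γ.toFirstOrderCalculus, formX Γ.toFirstOrderCalculus]) :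
    Function.Injective (formsMap Γ.toFirstOrderCalculus) := by
  rw [injective_iff_map_eq_zero]
  rintro ⟨a, b⟩ hab
  rw [formsMap_apply] at hab
  have h := BicovariantCalculus.eq_zero_of_sum_op_smul_eq_zero (a := ![a, b])
    (by
      intro i
      fin_cases i
      · exact formG_mem Γ
      · exact formX_mem Γ) hli (by simpa [Fin.sum_univ_two] using hab)
  exact Prod.ext (h 0) (h 1)

theorem linearIndependent_of_formsMap_injective {Γ : FirstOrderCalculus.{u, u, w} K (CqB q)}
    (hinj : Function.Injective (formsMap Γ)) : LinearIndependent K ![formG Γ, formX Γ] := by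
  have : Nontrivial (CqB q) := by
    refine ⟨1, 0, fun h => ?_⟩
    simpa using congrArg (Coalgebra.counit (R := K)) h
  rw [LinearIndependent.pair_iff]
  intro s t hst
  have h : formsMap Γ (s • 1, t • 1) = formsMap Γ 0 := by
    rw [formsMap_apply, map_zero, op_smul, op_smul, op_one, smul_assoc, smul_assoc, one_smul,
      one_smul, hst]
  have h' := Prod.mk.inj (hinj h)
  simpa using h'

theorem exists_dim_eq_two (hq0 : q ≠ 0) (hq1 : q ≠ 1) :
    ∃ Γ : BicovariantCalculus.{u, u, u} K (CqB q), Γ.dim = 2 := by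
  have h := Model.isStandard_calculus hq0 hq1
  have hinj := Model.formsMap_calculus_injective hq0 hq1
  exact ⟨bicovariantCalculus h hq0 hinj hq1, dim_eq_two hq0
    (Γ := bicovariantCalculus h hq0 hinj hq1) h (linearIndependent_of_formsMap_injective hinj)⟩

/-! ### Quotients and coirreducibility -/

section Hom

variable {Γ : FirstOrderCalculus.{u, u, w} K (CqB q)}
  {Γ' : FirstOrderCalculus.{u, u, w'} K (CqB q)} (φ : FirstOrderCalculus.Hom Γ Γ')

theorem map_formG : φ.toLinearMap (formG Γ) = formG Γ' := by
  rw [formG, φ.map_op_smul, φ.map_d, formG]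

theorem map_formX : φ.toLinearMap (formX Γ) = formX Γ' := by
  rw [formX, map_sub, φ.map_op_smul, φ.map_d, map_formG, formX]

include φ in
theorem IsStandard.map (h : IsStandard Γ) : IsStandard Γ' where
  g_smul_formG := by
    have e := congrArg φ.toLinearMap h.g_smul_formG
    rwa [LinearMap.map_smul_of_tower _ q, map_smul, φ.map_op_smul, map_formG] at e
  g_smul_formX := by
    have e := congrArg φ.toLinearMap h.g_smul_formX
    rwa [map_smul, φ.map_op_smul, map_formX] at e
  X_smul_formG := by
    have e := congrArg φ.toLinearMap h.X_smul_formG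
    rwa [map_add, LinearMap.map_smul_of_tower _ q, LinearMap.map_smul_of_tower _ (q - 1), map_smul,
      φ.map_op_smul, map_formG, map_formX] at e
  X_smul_formX := by
    have e := congrArg φ.toLinearMap h.X_smul_formX
    rwa [map_smul, φ.map_op_smul, map_formX] at e

end Hom

/-- A morphism carries the invariant forms to the invariant forms, so the target satisfies the
standard relations too. Unless it is zero, its two forms are free generators, and the morphism is
the identity in these coordinates. -/
theorem isCoirreducible (hq0 : q ≠ 0) (hq : ∀ n : ℕ, 0 < n → q ^ n ≠ 1)
    (Γ : BicovariantCalculus.{u, u, w} K (CqB q)) (hΓ : Γ.dim = 2) : Γ.IsCoirreducible := by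
  have hq1 : q ≠ 1 := by simpa using hq 1
  have h := isStandard hq0 hq Γ hΓ
  refine ⟨⟨_, _, formG_ne_zero hq0 hq Γ hΓ⟩, fun Γ' φ hΓ' => ?_⟩
  have h' := h.map φ
  have hmap : ∀ p, φ.toLinearMap (formsMap Γ.toFirstOrderCalculus p) =
      formsMap Γ'.toFirstOrderCalculus p := by
    rintro ⟨a, b⟩
    rw [formsMap_apply, formsMap_apply, map_add, φ.map_op_smul, φ.map_op_smul, map_formG, map_formX]
  have hu : formG Γ'.toFirstOrderCalculus ≠ 0 := by
    intro hu
    -- The relation X u = q u X + (q - 1) v produces v from u, so no nonzero quotient can kill u.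
    have hv : formX Γ'.toFirstOrderCalculus = 0 := by
      have e := h'.X_smul_formG
      rw [hu, smul_zero, smul_zero, smul_zero, zero_add, eq_comm, smul_eq_zero] at e
      exact e.resolve_left (sub_ne_zero.mpr hq1)
    obtain ⟨x, hx⟩ := exists_ne (0 : Γ'.carrier)
    obtain ⟨a, b, e⟩ := h'.exists_eq_op_smul_add hq0 x
    rw [hu, hv, smul_zero, smul_zero, add_zero] at e
    exact hx e
  have hinj := formsMap_injective (linearIndependent_forms hq0 hq1 hu)
  constructor
  · intro x y hxy
    obtain ⟨p, rfl⟩ := h.formsMap_surjective hq0 x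
    obtain ⟨p', rfl⟩ := h.formsMap_surjective hq0 y
    rw [hmap, hmap] at hxy
    rw [hinj hxy]
  · intro y
    obtain ⟨p, rfl⟩ := h'.formsMap_surjective hq0 y
    exact ⟨_, hmap p⟩

end CqB

theorem mainTheorem4 {K : Type u} [Field K] [CharZero K] (q : K) (hq0 : q ≠ 0)
    (hq : ∀ n : ℕ, 0 < n → q ^ n ≠ 1) :
    (∃ Γ₀ : BicovariantCalculus.{u, u, u} K (CqB q), Γ₀.dim = 2) ∧
    (∀ (Γ : BicovariantCalculus.{u, u, w} K (CqB q)) (Γ' : BicovariantCalculus.{u, u, w'} K (CqB q)),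
      Γ.dim = 2 → Γ'.dim = 2 →
        FirstOrderCalculus.IsIsomorphic Γ.toFirstOrderCalculus Γ'.toFirstOrderCalculus) ∧
    (∀ Γ : BicovariantCalculus.{u, u, w} K (CqB q), Γ.dim = 2 →
      Γ.IsCoirreducible ∧
      Γ.qComm 1 (CqB.g q) (Γ.d (CqB.X q)) = 0 ∧
      Γ.qComm q (CqB.g q) (Γ.d (CqB.g q)) = 0 ∧
      Γ.qComm q (CqB.X q) (Γ.d (CqB.X q)) = 0 ∧
      Γ.qComm q (CqB.X q) (Γ.d (CqB.g q)) =
        (q - 1) • (MulOpposite.op (CqB.g q) • Γ.d (CqB.X q)) ∧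
      ∀ f : PolyXg K, Γ.d (PolyXg.normalOrder q f) =
        MulOpposite.op (PolyXg.normalOrder q (PolyXg.qDerivG q f)) • Γ.d (CqB.g q) +
        MulOpposite.op (PolyXg.normalOrder q (PolyXg.qDerivX q f)) • Γ.d (CqB.X q)) := by
  have hq1 : q ≠ 1 := by simpa using hq 1
  refine ⟨CqB.exists_dim_eq_two hq0 hq1, fun Γ Γ' hΓ hΓ' => ?_, fun Γ hΓ => ?_⟩
  · exact CqB.isIsomorphic_of_injective (CqB.isStandard hq0 hq Γ hΓ) hq0 hq1
      (CqB.formsMap_injective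
        (CqB.linearIndependent_forms hq0 hq1 (CqB.formG_ne_zero hq0 hq Γ hΓ)))
      (CqB.isStandard hq0 hq Γ' hΓ')
      (CqB.formsMap_injective
        (CqB.linearIndependent_forms hq0 hq1 (CqB.formG_ne_zero hq0 hq Γ' hΓ')))
  · have h := CqB.isStandard hq0 hq Γ hΓ
    exact ⟨CqB.isCoirreducible hq0 hq Γ hΓ, h.qComm_g_d_X, h.qComm_g_d_g, h.qComm_X_d_X,
      h.qComm_X_d_g, h.d_normalOrder hq0 hq1⟩
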